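/- Let $n,N\in\mathbb N$, $c_1,\dots,c_N>0$ and $\omega_1,\dots,\omega_N\in\mathbb R^n$, where the $\omega_\ell$ are not all equal, and put $$f(x)=\log\sum_{\ell=1}^N c_\ell e^{\langle\omega_\ell,x\rangle},\qquad \Omega=\{\omega_1,\dots,\omega_N\},\qquad L_\Omega=\max_{\ell}\|\omega_\ell\|^2,\qquad \beta=\frac{\sum_\ell c_\ell}{\min_\ell c_\ell}.$$ Let $m$ be the dimension of the affine hull of $\Omega$, and let $\varphi>0$ be the smallest distance from a point $\omega\in\Omega$ to the affine span of a facet of $\operatorname{Conv}\Omega$ not containing $\omega$. Let $p^\star$ be the point of minimum Euclidean norm of the closure of $\operatorname{dom}f^*=\{p : f^*(p)<\infty\}$, where $f^*(p)=\sup_x(\langle p,x\rangle-f(x))$, and let $g(x)=f(x)-\langle p^\star,x\rangle$. Then $f$ is convex and $L_\Omega$-smooth (i.e. differentiable with $L_\Omega$-Lipschitz gradient, $L_\Omega>0$) and $g$ is bounded below. Moreover, let $L>0$ be any constant such that $f$ is $L$-smooth (for instance $L=L_\Omega$), and let $(A_k)_{k\ge0}$ be real numbers such that, with $\delta^+A_k=A_{k+1}-A_k$,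 $$A_0=0,\qquad 0<\delta^+A_k\le 2\sqrt{A_{k+1}/L}\quad(k\ge0),\qquad \delta^+A_k=\Theta(k).$$ Let $(x^{(k)})$ be generated by the accelerated gradient method started at $x^{(0)}=y^{(0)}=0$, $$x^{(k+1)}=y^{(k)}-\frac{(\delta^+A_k)^2}{4A_{k+1}}\nabla f(y^{(k)}),\qquad y^{(k+1)}=x^{(k+1)}+\frac{A_k\,\delta^+A_{k+1}}{A_{k+2}\,\delta^+A_k}\bigl(x^{(k+1)}-x^{(k)}\bigr),$$ or in its three-sequence form with $x^{(0)}=z^{(0)}=0$, $$y^{(k)}-x^{(k)}=\tfrac{\delta^+A_k}{A_{k+1}}(z^{(k)}-x^{(k)}),\quad z^{(k+1)}-z^{(k)}=-\tfrac{\delta^+A_k}{4}\nabla f(y^{(k)}),\quad A_k(x^{(k+1)}-x^{(k)})=\delta^+A_k\,(z^{(k+1)}-x^{(k+1)}).$$ Then $A_k>m^2/(\beta\varphi^2)$ for all sufficiently large $k$, and for every $k$ with $A_k>m^2/(\beta\varphi^2)$, $$\frac{\|\nabla f(x^{(k)})-p^\star\|^2}{2L_\Omega}\le g(x^{(k)})-\inf_{x\in\mathbb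 R^n}g(x)\le\frac{2m^2}{\varphi^2A_k}\Bigl(1+\log^2\Bigl(\frac{\beta\varphi^2A_k}{m^2}\Bigr)\Bigr),$$ where the right-hand side is $O(k^{-2}\log^2k)$ as $k\to\infty$. -/

import Mathlib

open Filter Asymptotics Topology

/-- The Euclidean space `ℝⁿ`. -/
abbrev Vec (n : ℕ) : Type := EuclideanSpace ℝ (Fin n)

noncomputable section

/-! Convex functions, conjugates, minimum-norm points -/

/-- The class of `L`-smooth convex functions on `ℝⁿ` (`L > 0`): finite-valued differentiable
convex functions with `L`-Lipschitz gradient. -/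
structure IsSmoothConvex {n : ℕ} (L : ℝ) (f : Vec n → ℝ) : Prop where
  pos : 0 < L
  convex : ConvexOn ℝ Set.univ f
  differentiable : Differentiable ℝ f
  lipschitz : ∀ x y : Vec n, ‖gradient f x - gradient f y‖ ≤ L * ‖x - y‖

/-- The Legendre--Fenchel conjugate `f*(p) = sup_x (⟨p, x⟩ - f x)`, with extended real values. -/
def fenchelConjugate {n : ℕ} (f : Vec n → ℝ) (p : Vec n) : EReal :=
  ⨆ x : Vec n, ((inner ℝ p x - f x : ℝ) : EReal)

/-- The domain of the conjugate, `{p | f*(p) < ∞}`. -/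
def conjugateDomain {n : ℕ} (f : Vec n → ℝ) : Set (Vec n) :=
  {p | fenchelConjugate f p < ⊤}

/-- `p` is a point of minimum Euclidean norm of the set `S`. -/
def IsMinNormPoint {n : ℕ} (p : Vec n) (S : Set (Vec n)) : Prop :=
  p ∈ S ∧ ∀ q ∈ S, ‖p‖ ≤ ‖q‖

/-- The tilted function `x ↦ f x - ⟨p, x⟩`. -/
def tilt {n : ℕ} (f : Vec n → ℝ) (p : Vec n) (x : Vec n) : ℝ :=
  f x - inner ℝ p x

/-! The accelerated gradient method -/

/-- The forward difference `δ⁺A_k = A_{k+1} - A_k`. -/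
def stepDiff (A : ℕ → ℝ) (k : ℕ) : ℝ := A (k + 1) - A k

/-- The step-size condition: `A_0 = 0`, `0 < δ⁺A_k ≤ 2 √(A_{k+1} / L)` and `δ⁺A_k = Θ(k)`. -/
structure StepSizeCondition (L : ℝ) (A : ℕ → ℝ) : Prop where
  zero : A 0 = 0
  pos : ∀ k, 0 < stepDiff A k
  le : ∀ k, stepDiff A k ≤ 2 * Real.sqrt (A (k + 1) / L)
  theta : (fun k : ℕ => stepDiff A k) =Θ[atTop] (fun k : ℕ => (k : ℝ))

/-- The accelerated gradient method in its three-sequence form. The third update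
`x_{k+1} - x_k = (δ⁺A_k / A_k) (z_{k+1} - x_{k+1})` is multiplied by `A_k`, so that for `k = 0`,
where `A_0 = 0`, it reads `x_1 = z_1`. -/
structure IsAGMThree {n : ℕ} (f : Vec n → ℝ) (A : ℕ → ℝ) (x₀ : Vec n)
    (x y z : ℕ → Vec n) : Prop where
  x_zero : x 0 = x₀
  z_zero : z 0 = x₀
  y_step : ∀ k, y k - x k = (stepDiff A k / A (k + 1)) • (z k - x k)
  z_step : ∀ k, z (k + 1) - z k = -((stepDiff A k / 4) • gradient f (y k))
  x_step : ∀ k, A k • (x (k + 1) - x k) = stepDiff A k • (z (k + 1) - x (k + 1))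

/-- The accelerated gradient method in its reduced two-sequence form. -/
structure IsAGMTwo {n : ℕ} (f : Vec n → ℝ) (A : ℕ → ℝ) (x₀ : Vec n)
    (x y : ℕ → Vec n) : Prop where
  x_zero : x 0 = x₀
  y_zero : y 0 = x₀
  x_step : ∀ k, x (k + 1) = y k - ((stepDiff A k) ^ 2 / (4 * A (k + 1))) • gradient f (y k)
  y_step : ∀ k, y (k + 1) = x (k + 1) +
    (A k * stepDiff A (k + 1) / (A (k + 2) * stepDiff A k)) • (x (k + 1) - x k)

/-- `x` is the sequence of iterates `x^{(k)}` of the accelerated gradient method with parameters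
`A` and initial point `x₀`, in either of the two formulations. -/
def IsAGMIterates {n : ℕ} (f : Vec n → ℝ) (A : ℕ → ℝ) (x₀ : Vec n) (x : ℕ → Vec n) : Prop :=
  (∃ y : ℕ → Vec n, IsAGMTwo f A x₀ x y) ∨ (∃ y z : ℕ → Vec n, IsAGMThree f A x₀ x y z)

/-! Geometric programming -/

/-- The objective `f(x) = log ∑_ℓ c_ℓ exp ⟨ω_ℓ, x⟩`. -/
def gpObjective {n N : ℕ} (c : Fin N → ℝ) (ω : Fin N → Vec n) (x : Vec n) : ℝ :=
  Real.log (∑ l, c l * Real.exp (inner ℝ (ω l) x))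

/-- `L_Ω = max_ℓ ‖ω_ℓ‖²`. -/
def gpSmoothness {n N : ℕ} (ω : Fin N → Vec n) : ℝ := ⨆ l, ‖ω l‖ ^ 2

/-- `β = (∑_ℓ c_ℓ) / c_min`, with `c_min = min_ℓ c_ℓ`. -/
def gpBeta {N : ℕ} (c : Fin N → ℝ) : ℝ := (∑ l, c l) / ⨅ l, c l

/-- The Newton polytope `Conv Ω`, with `Ω = {ω_1, …, ω_N}`. -/
def newtonPolytope {n N : ℕ} (ω : Fin N → Vec n) : Set (Vec n) :=
  convexHull ℝ (Set.range ω)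

/-- The dimension of the affine hull of a set. -/
def affDim {n : ℕ} (S : Set (Vec n)) : ℕ := Module.finrank ℝ (vectorSpan ℝ S)

/-- `F` is a facet of `P`: a nonempty exposed face whose dimension is one less than that
of `P`. (The faces of a polytope are exactly its exposed faces.) -/
def IsFacet {n : ℕ} (P F : Set (Vec n)) : Prop :=
  IsExposed ℝ P F ∧ F.Nonempty ∧ affDim F + 1 = affDim P

/-- The facet gap `φ`: the smallest distance from any `ω ∈ Ω` to the affine span of any facet
of `Conv Ω` not containing `ω`. -/
def facetGap {n N : ℕ} (ω : Fin N → Vec n) : ℝ :=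
  sInf {d : ℝ | ∃ (l : Fin N) (F : Set (Vec n)), IsFacet (newtonPolytope ω) F ∧ ω l ∉ F ∧
    d = Metric.infDist (ω l) (affineSpan ℝ F : Set (Vec n))}

/-- The bound `(2 m² / (φ² a)) (1 + log² (β φ² a / m²))`. -/
def gpBound (m β φ a : ℝ) : ℝ :=
  2 * m ^ 2 / (φ ^ 2 * a) * (1 + Real.log (β * φ ^ 2 * a / m ^ 2) ^ 2)

end

/-!
Let `p` be the point of minimum norm. Since gradients of `f` lie in `dom f*`, the gradient of
`g = f - ⟨p, ·⟩` always makes a nonnegative inner product with `p`, so `g` does not increase along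
`-p`. A step along `-∇f` is a step along `-∇g` followed by a move along `-p`; hence the accelerated
method applied to `f` still satisfies the usual energy estimate for `g`, which gives
`A k * (g (x k) - g u) ≤ 2 ‖u‖²` for every `u`.

The infimum of `g` need not be attained, but every value of `g` is nearly matched at a point of
controlled norm. If `x` lies in the normal cone of the Newton polytope at `ω i`, write it as a
nonnegative combination of at most `m` unit extreme rays of that cone and truncate the coefficients
at `T`. Each ray is normal to a facet, so the exponents off that facet lie at least `φ` below it in
this direction: truncation does not increase the terms lying on the truncated facets and leaves the
other ones smaller than the largest by a factor `exp (-φ T)`. This yields `‖u‖ ≤ m T` and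
`g u ≤ g x + β exp (-φ T)`, and `T = log (β φ² A k / m²) / φ` balances the two errors.
-/

section FirstOrder

variable {E : Type*} [NormedAddCommGroup E] [InnerProductSpace ℝ E] {f : E → ℝ}

theorem convexOn_of_forall_exists_add_inner_le {s : Set E} (hs : Convex ℝ s)
    (h : ∀ x ∈ s, ∃ v : E, ∀ y ∈ s, f x + inner ℝ v (y - x) ≤ f y) : ConvexOn ℝ s f := by
  refine ⟨hs, fun x hx y hy a b ha hb hab => ?_⟩
  obtain ⟨v, hv⟩ := h _ (hs hx hy ha hb hab)
  have hx' := mul_le_mul_of_nonneg_left (hv x hx) ha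
  have hy' := mul_le_mul_of_nonneg_left (hv y hy) hb
  simp only [inner_sub_right, inner_add_right, real_inner_smul_right, smul_eq_mul] at hx' hy' ⊢
  obtain rfl : b = 1 - a := by linarith
  linarith

variable [CompleteSpace E]

theorem hasDerivAt_add_smul_of_hasGradientAt {x d v : E} {t : ℝ}
    (hf : HasGradientAt f v (x + t • d)) :
    HasDerivAt (fun t : ℝ => f (x + t • d)) (inner ℝ v d) t := by
  have hline : HasDerivAt (fun t : ℝ => x + t • d) d t := by
    simpa using ((hasDerivAt_id t).smul_const d).const_add x
  simpa [Function.comp_def] using hf.hasFDerivAt.comp_hasDerivAt t hline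

theorem add_inner_le_of_convexOn {s : Set E} (hf : ConvexOn ℝ s f) {x y v : E} (hx : x ∈ s)
    (hy : y ∈ s) (hv : HasGradientAt f v x) : f x + inner ℝ v (y - x) ≤ f y := by
  have hconv := hf.comp_affineMap (AffineMap.lineMap x y)
  have hderiv : HasDerivAt (f ∘ AffineMap.lineMap (k := ℝ) x y) (inner ℝ v (y - x)) 0 := by
    have h : HasDerivAt (fun t : ℝ => f (x + t • (y - x))) (inner ℝ v (y - x)) 0 :=
      hasDerivAt_add_smul_of_hasGradientAt (by simpa using hv)
    simpa [Function.comp_def, AffineMap.lineMap_apply, add_comm] using h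
  have hslope := hconv.le_slope_of_hasDerivAt (by simpa using hx) (by simpa using hy) one_pos hderiv
  simp only [slope_def_field, Function.comp_apply, AffineMap.lineMap_apply_one,
    AffineMap.lineMap_apply_zero, sub_zero, div_one] at hslope
  linarith

theorem le_add_inner_gradient_add_norm_sq (hf : Differentiable ℝ f) {L : ℝ}
    (hL : ∀ x y, ‖gradient f x - gradient f y‖ ≤ L * ‖x - y‖) (x y : E) :
    f y ≤ f x + inner ℝ (gradient f x) (y - x) + L / 2 * ‖y - x‖ ^ 2 := by
  set d := y - x
  set ψ : ℝ → ℝ := fun t => f (x + t • d) - t * inner ℝ (gradient f x) d -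
    L / 2 * ‖d‖ ^ 2 * t ^ 2 with hψ
  have hderiv (t : ℝ) : HasDerivAt ψ (inner ℝ (gradient f (x + t • d) - gradient f x) d -
      L * ‖d‖ ^ 2 * t) t := by
    have hline := hasDerivAt_add_smul_of_hasGradientAt (hf (x + t • d)).hasGradientAt
    refine ((hline.sub ((hasDerivAt_id t).mul_const _)).sub
      ((hasDerivAt_pow 2 t).const_mul _)).congr_deriv ?_
    rw [inner_sub_left]
    norm_num
    ring
  have hanti : AntitoneOn ψ (Set.Ici 0) := by
    refine antitoneOn_of_hasDerivWithinAt_nonpos (convex_Ici 0)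
      (fun t _ => (hderiv t).continuousAt.continuousWithinAt)
      (fun t _ => (hderiv t).hasDerivWithinAt) fun t ht => ?_
    rw [interior_Ici] at ht
    have hlip := hL (x + t • d) x
    rw [add_sub_cancel_left, norm_smul, Real.norm_of_nonneg (le_of_lt ht)] at hlip
    calc _ ≤ L * (t * ‖d‖) * ‖d‖ - L * ‖d‖ ^ 2 * t := by
          gcongr
          exact (real_inner_le_norm _ _).trans (by gcongr)
      _ = 0 := by ring
  have h01 := hanti Set.self_mem_Ici (Set.mem_Ici.2 zero_le_one) zero_le_one
  simp only [hψ, d, one_smul, zero_smul, add_zero, add_sub_cancel] at h01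
  linarith

end FirstOrder

section SmoothConvex

variable {n : ℕ} {f : Vec n → ℝ} {L : ℝ}

theorem hasGradientAt_tilt (hf : Differentiable ℝ f) (p x : Vec n) :
    HasGradientAt (tilt f p) (gradient f x - p) x := by
  rw [hasGradientAt_iff_hasFDerivAt, map_sub]
  exact (hf x).hasGradientAt.hasFDerivAt.sub (innerSL ℝ p).hasFDerivAt

theorem gradient_tilt (hf : Differentiable ℝ f) (p x : Vec n) :
    gradient (tilt f p) x = gradient f x - p :=
  (hasGradientAt_tilt hf p x).gradient

namespace IsSmoothConvex

protected theorem tilt (hf : IsSmoothConvex L f) (p : Vec n) : IsSmoothConvex L (tilt f p) where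
  pos := hf.pos
  convex := hf.convex.sub ((innerSL ℝ p).toLinearMap.concaveOn convex_univ)
  differentiable x := (hasGradientAt_tilt hf.differentiable p x).differentiableAt
  lipschitz x y := by
    simpa only [gradient_tilt hf.differentiable, sub_sub_sub_cancel_right] using hf.lipschitz x y

theorem add_inner_gradient_le (hf : IsSmoothConvex L f) (x y : Vec n) :
    f x + inner ℝ (gradient f x) (y - x) ≤ f y :=
  add_inner_le_of_convexOn hf.convex (Set.mem_univ x) (Set.mem_univ y)
    (hf.differentiable x).hasGradientAt

theorem sub_smul_gradient_le (hf : IsSmoothConvex L f) (x : Vec n) {s : ℝ} (hs : 0 ≤ s)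
    (hLs : L * s ≤ 1) : f (x - s • gradient f x) ≤ f x - s / 2 * ‖gradient f x‖ ^ 2 := by
  have h := le_add_inner_gradient_add_norm_sq hf.differentiable hf.lipschitz x
    (x - s • gradient f x)
  rw [sub_sub_cancel_left, inner_neg_right, real_inner_smul_right, real_inner_self_eq_norm_sq,
    norm_neg, norm_smul, Real.norm_of_nonneg hs] at h
  have hquad : L * s * (s * ‖gradient f x‖ ^ 2) ≤ 1 * (s * ‖gradient f x‖ ^ 2) := by gcongr
  linarith

theorem norm_gradient_sq_div_le (hf : IsSmoothConvex L f) (hbdd : BddBelow (Set.range f))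
    (x : Vec n) : ‖gradient f x‖ ^ 2 / (2 * L) ≤ f x - ⨅ u, f u := by
  have hL := hf.pos
  have hdesc := hf.sub_smul_gradient_le x (inv_nonneg.2 hL.le) (mul_inv_cancel₀ hL.ne').le
  have hinf := ciInf_le hbdd (x - L⁻¹ • gradient f x)
  have hcoeff : L⁻¹ / 2 * ‖gradient f x‖ ^ 2 = ‖gradient f x‖ ^ 2 / (2 * L) := by field_simp
  linarith

theorem sub_smul_le (hf : IsSmoothConvex L f) {p : Vec n}
    (hp : ∀ x, 0 ≤ inner ℝ (gradient f x) p) (x : Vec n) {t : ℝ} (ht : 0 ≤ t) :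
    f (x - t • p) ≤ f x := by
  have h := hf.add_inner_gradient_le (x - t • p) x
  rw [sub_sub_cancel, real_inner_smul_right] at h
  linarith [mul_nonneg ht (hp (x - t • p))]

end IsSmoothConvex

end SmoothConvex

section Conjugate

variable {n : ℕ} {f : Vec n → ℝ}

theorem mem_conjugateDomain_iff {p : Vec n} :
    p ∈ conjugateDomain f ↔ BddBelow (Set.range (tilt f p)) := by
  constructor
  · intro hp
    obtain ⟨B, hB, -⟩ := EReal.lt_iff_exists_real_btwn.1 (show fenchelConjugate f p < ⊤ from hp)
    refine ⟨-B, ?_⟩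
    rintro _ ⟨x, rfl⟩
    have hx : ((inner ℝ p x - f x : ℝ) : EReal) ≤ B := (le_iSup_iff.2 fun b hb => hb x).trans hB.le
    rw [EReal.coe_le_coe_iff] at hx
    rw [tilt]
    linarith
  · rintro ⟨B, hB⟩
    refine (iSup_le fun x => ?_).trans_lt (EReal.coe_lt_top (-B))
    have hx : B ≤ f x - inner ℝ p x := hB (Set.mem_range_self x)
    exact EReal.coe_le_coe (by linarith)

theorem convex_conjugateDomain (f : Vec n → ℝ) : Convex ℝ (conjugateDomain f) := by
  intro p hp q hq a b ha hb hab
  rw [mem_conjugateDomain_iff] at *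
  obtain ⟨B, hB⟩ := hp
  obtain ⟨D, hD⟩ := hq
  refine ⟨a * B + b * D, ?_⟩
  rintro _ ⟨x, rfl⟩
  have hcomb : tilt f (a • p + b • q) x = a * tilt f p x + b * tilt f q x := by
    obtain rfl : b = 1 - a := by linarith
    simp only [tilt, inner_add_left, real_inner_smul_left]
    ring
  rw [hcomb]
  gcongr
  exacts [hB (Set.mem_range_self x), hD (Set.mem_range_self x)]

theorem IsSmoothConvex.gradient_mem_conjugateDomain {L : ℝ} (hf : IsSmoothConvex L f)
    (x : Vec n) : gradient f x ∈ conjugateDomain f := by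
  rw [mem_conjugateDomain_iff]
  refine ⟨tilt f (gradient f x) x, ?_⟩
  rintro _ ⟨y, rfl⟩
  have h := hf.add_inner_gradient_le x y
  rw [inner_sub_right] at h
  simp only [tilt]
  linarith

theorem IsMinNormPoint.inner_sub_nonneg {S : Set (Vec n)} {p q : Vec n} (hp : IsMinNormPoint p S)
    (hS : Convex ℝ S) (hq : q ∈ S) : 0 ≤ inner ℝ (q - p) p := by
  have : Nonempty S := ⟨⟨p, hp.1⟩⟩
  have hinf : ‖0 - p‖ = ⨅ w : S, ‖0 - (w : Vec n)‖ := by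
    refine le_antisymm (le_ciInf fun w => ?_) (ciInf_le ⟨0, ?_⟩ (⟨p, hp.1⟩ : S))
    · simpa using hp.2 w w.2
    · rintro _ ⟨w, rfl⟩
      exact norm_nonneg _
  have h := (norm_eq_iInf_iff_real_inner_le_zero hS hp.1).1 hinf q hq
  rwa [zero_sub, inner_neg_left, real_inner_comm, neg_nonpos] at h

theorem IsSmoothConvex.inner_gradient_tilt_nonneg {L : ℝ} (hf : IsSmoothConvex L f) {p : Vec n}
    (hp : IsMinNormPoint p (closure (conjugateDomain f))) (x : Vec n) :
    0 ≤ inner ℝ (gradient (tilt f p) x) p := by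
  rw [gradient_tilt hf.differentiable]
  exact hp.inner_sub_nonneg (convex_conjugateDomain f).closure
    (subset_closure (hf.gradient_mem_conjugateDomain x))

end Conjugate

section AcceleratedGradient

variable {n : ℕ} {f : Vec n → ℝ} {L : ℝ} {A : ℕ → ℝ} {x₀ : Vec n} {x y z : ℕ → Vec n}

theorem succ_eq_add_stepDiff (A : ℕ → ℝ) (k : ℕ) : A (k + 1) = A k + stepDiff A k := by
  rw [stepDiff, add_sub_cancel]

namespace StepSizeCondition

theorem nonneg (hA : StepSizeCondition L A) (k : ℕ) : 0 ≤ A k := by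
  rw [← hA.zero]
  exact monotone_nat_of_le_succ (fun k => (sub_pos.1 (hA.pos k)).le) (Nat.zero_le k)

theorem succ_pos (hA : StepSizeCondition L A) (k : ℕ) : 0 < A (k + 1) :=
  (hA.nonneg k).trans_lt (sub_pos.1 (hA.pos k))

theorem mul_stepDiff_sq_div_le_one (hA : StepSizeCondition L A) (hL : 0 < L) (k : ℕ) :
    L * (stepDiff A k ^ 2 / (4 * A (k + 1))) ≤ 1 := by
  have hA' := hA.succ_pos k
  have h := pow_le_pow_left₀ (hA.pos k).le (hA.le k) 2
  rw [mul_pow, Real.sq_sqrt (by positivity)] at h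
  calc L * (stepDiff A k ^ 2 / (4 * A (k + 1)))
      ≤ L * (2 ^ 2 * (A (k + 1) / L) / (4 * A (k + 1))) := by gcongr
    _ = 1 := by field_simp; norm_num

end StepSizeCondition

theorem IsAGMTwo.exists_isAGMThree (h : IsAGMTwo f A x₀ x y) (hA : ∀ k, A (k + 1) ≠ 0)
    (hδ : ∀ k, stepDiff A k ≠ 0) : ∃ z, IsAGMThree f A x₀ x y z := by
  let z : ℕ → Vec n := fun k => x k + (A (k + 1) / stepDiff A k) • (y k - x k)
  have hz_succ (k : ℕ) : z (k + 1) = x (k + 1) + (A k / stepDiff A k) • (x (k + 1) - x k) := by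
    have hA₂ := hA (k + 1)
    have hδ₁ := hδ (k + 1)
    simp only [z, h.y_step k, add_sub_cancel_left, smul_smul]
    congr 2
    field_simp
  refine ⟨z, h.x_zero, by simp [z, h.x_zero, h.y_zero], fun k => ?_, fun k => ?_, fun k => ?_⟩
  · simp only [z, add_sub_cancel_left, smul_smul]
    rw [div_mul_div_cancel₀ (hA k), div_self (hδ k), one_smul]
  · have hAk := hA k
    have hδk := hδ k
    rw [hz_succ, h.x_step, show A k = A (k + 1) - stepDiff A k by rw [stepDiff]; ring]
    simp only [z]
    match_scalars <;> field_simp <;> ring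
  · rw [hz_succ, add_sub_cancel_left, smul_smul, mul_div_cancel₀ _ (hδ k)]

namespace IsAGMThree

theorem smul_y (h : IsAGMThree f A x₀ x y z) {k : ℕ} (hA : A (k + 1) ≠ 0) :
    A (k + 1) • y k = A k • x k + stepDiff A k • z k := by
  rw [← sub_add_cancel (y k) (x k), h.y_step, smul_add, smul_smul, mul_div_cancel₀ _ hA,
    succ_eq_add_stepDiff A k]
  module

theorem z_succ (h : IsAGMThree f A x₀ x y z) (k : ℕ) :
    z (k + 1) = z k - (stepDiff A k / 4) • gradient f (y k) := by
  rw [sub_eq_add_neg, ← h.z_step, add_sub_cancel]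

theorem x_succ (h : IsAGMThree f A x₀ x y z) {k : ℕ} (hA : A (k + 1) ≠ 0) :
    x (k + 1) = y k - (stepDiff A k ^ 2 / (4 * A (k + 1))) • gradient f (y k) := by
  have hx : A (k + 1) • x (k + 1) = A k • x k + stepDiff A k • z (k + 1) := by
    have hstep := h.x_step k
    rw [smul_sub, smul_sub, sub_eq_sub_iff_add_eq_add] at hstep
    rw [succ_eq_add_stepDiff A k, add_smul, hstep, add_comm]
  refine smul_right_injective _ hA ?_
  simp only [smul_sub, hx, h.smul_y hA, h.z_succ, smul_smul]
  rw [add_sub_assoc]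
  congr 3
  field_simp

theorem tilt_x_succ_le (h : IsAGMThree f A x₀ x y z) (hf : IsSmoothConvex L f) {p : Vec n}
    (hp : ∀ x, 0 ≤ inner ℝ (gradient (tilt f p) x) p) {k : ℕ} (hA : 0 < A (k + 1))
    (hstep : L * (stepDiff A k ^ 2 / (4 * A (k + 1))) ≤ 1) :
    A (k + 1) * tilt f p (x (k + 1)) ≤
      A (k + 1) * tilt f p (y k) - stepDiff A k ^ 2 / 8 * ‖gradient (tilt f p) (y k)‖ ^ 2 := by
  set G := gradient (tilt f p) (y k) with hG
  set s := stepDiff A k ^ 2 / (4 * A (k + 1)) with hs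
  have hs₀ : 0 ≤ s := by positivity
  have hx : x (k + 1) = y k - s • G - s • p := by
    rw [h.x_succ hA.ne', hG, gradient_tilt hf.differentiable]
    module
  calc A (k + 1) * tilt f p (x (k + 1)) ≤ A (k + 1) * (tilt f p (y k) - s / 2 * ‖G‖ ^ 2) := by
        gcongr
        rw [hx]
        exact ((hf.tilt p).sub_smul_le hp _ hs₀).trans
          ((hf.tilt p).sub_smul_gradient_le _ hs₀ hstep)
    _ = A (k + 1) * tilt f p (y k) - stepDiff A k ^ 2 / 8 * ‖G‖ ^ 2 := by
        rw [hs]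
        field_simp
        ring

theorem sub_weighted_le (h : IsAGMThree f A x₀ x y z) {g : Vec n → ℝ} (hg : IsSmoothConvex L g)
    {k : ℕ} (hA₀ : 0 ≤ A k) (hA : A (k + 1) ≠ 0) (hδ : 0 ≤ stepDiff A k) (u : Vec n) :
    A (k + 1) * g (y k) - A k * g (x k) - stepDiff A k * g u ≤
      stepDiff A k * inner ℝ (gradient g (y k)) (z k - u) := by
  have hx := mul_le_mul_of_nonneg_left (hg.add_inner_gradient_le (y k) (x k)) hA₀
  have hu := mul_le_mul_of_nonneg_left (hg.add_inner_gradient_le (y k) u) hδ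
  have hy := congrArg (inner ℝ (gradient g (y k))) (h.smul_y hA)
  rw [succ_eq_add_stepDiff A k] at hy ⊢
  simp only [inner_add_right, inner_sub_right, real_inner_smul_right] at hx hu hy ⊢
  linarith

-- The method follows `∇f` rather than the gradient of the tilted function; adding `(A k / 4) • p`
-- to `z k` turns its update into the mirror step for the latter.
theorem energy_succ_le (h : IsAGMThree f A x₀ x y z) (hf : IsSmoothConvex L f) {p : Vec n}
    (hp : ∀ x, 0 ≤ inner ℝ (gradient (tilt f p) x) p) {k : ℕ} (hA₀ : 0 ≤ A k)
    (hδ : 0 < stepDiff A k) (hstep : L * (stepDiff A k ^ 2 / (4 * A (k + 1))) ≤ 1) (u : Vec n) :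
    A (k + 1) * (tilt f p (x (k + 1)) - tilt f p u) + 2 * ‖z (k + 1) + (A (k + 1) / 4) • p - u‖ ^ 2
      ≤ A k * (tilt f p (x k) - tilt f p u) + 2 * ‖z k + (A k / 4) • p - u‖ ^ 2 := by
  have hsucc := succ_eq_add_stepDiff A k
  have hA : 0 < A (k + 1) := by linarith
  set δ := stepDiff A k
  set G := gradient (tilt f p) (y k) with hG
  set w := z k + (A k / 4) • p - u with hw
  have hgradient := h.tilt_x_succ_le hf hp hA hstep
  have hconvex := h.sub_weighted_le (hf.tilt p) hA₀ hA.ne' hδ.le u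
  have hmirror : z (k + 1) + (A (k + 1) / 4) • p - u = w - (δ / 4) • G := by
    rw [h.z_succ, hw, hG, gradient_tilt hf.differentiable, hsucc]
    module
  have hnorm : 2 * ‖w - (δ / 4) • G‖ ^ 2 = 2 * ‖w‖ ^ 2 - δ * inner ℝ G w + δ ^ 2 / 8 * ‖G‖ ^ 2 := by
    rw [norm_sub_sq_real, norm_smul, real_inner_smul_right, real_inner_comm, mul_pow,
      Real.norm_eq_abs, sq_abs]
    ring
  have hdrift : δ * inner ℝ G (z k - u) ≤ δ * inner ℝ G w := by
    gcongr
    rw [hw, add_sub_right_comm, inner_add_right, real_inner_smul_right]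
    exact le_add_of_nonneg_right (mul_nonneg (by positivity) (hp _))
  have hu : A (k + 1) * tilt f p u = A k * tilt f p u + δ * tilt f p u := by
    rw [hsucc, add_mul]
  rw [hmirror, hnorm]
  linarith

end IsAGMThree

theorem IsAGMIterates.tilt_sub_le (h : IsAGMIterates f A x₀ x) (hf : IsSmoothConvex L f)
    (hA : StepSizeCondition L A) {p : Vec n}
    (hp : IsMinNormPoint p (closure (conjugateDomain f))) (u : Vec n) (k : ℕ) :
    A k * (tilt f p (x k) - tilt f p u) ≤ 2 * ‖x₀ - u‖ ^ 2 := by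
  obtain ⟨y, z, h⟩ : ∃ y z, IsAGMThree f A x₀ x y z := by
    rcases h with ⟨y, h⟩ | h
    exacts [⟨y, h.exists_isAGMThree (fun k => (hA.succ_pos k).ne') fun k => (hA.pos k).ne'⟩, h]
  have henergy : A k * (tilt f p (x k) - tilt f p u) + 2 * ‖z k + (A k / 4) • p - u‖ ^ 2 ≤
      2 * ‖x₀ - u‖ ^ 2 := by
    induction k with
    | zero => simp [hA.zero, h.z_zero]
    | succ k ih =>
      exact (h.energy_succ_le hf (hf.inner_gradient_tilt_nonneg hp) (hA.nonneg k) (hA.pos k)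
        (hA.mul_stepDiff_sq_div_le_one hf.pos k) u).trans ih
  linarith [sq_nonneg ‖z k + (A k / 4) • p - u‖]

end AcceleratedGradient

section Rate

theorem isBigO_sum_range {E : Type*} [SeminormedAddCommGroup E] {f : ℕ → E} {g : ℕ → ℝ}
    (hg : ∀ k, 0 < g k) (h : f =O[atTop] g) :
    (fun k => ∑ i ∈ Finset.range k, f i) =O[atTop] fun k => ∑ i ∈ Finset.range k, g i := by
  obtain ⟨C, -, hC⟩ := bound_of_isBigO_nat_atTop h
  refine IsBigO.of_bound C (Eventually.of_forall fun k => ?_)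
  rw [Real.norm_of_nonneg (Finset.sum_nonneg fun i _ => (hg i).le), Finset.mul_sum]
  refine norm_sum_le_of_le _ fun i _ => ?_
  simpa only [Real.norm_of_nonneg (hg i).le] using hC (hg i).ne'

theorem isTheta_sum_range {f g : ℕ → ℝ} (hf : ∀ k, 0 < f k) (hg : ∀ k, 0 < g k)
    (h : f =Θ[atTop] g) :
    (fun k => ∑ i ∈ Finset.range k, f i) =Θ[atTop] fun k => ∑ i ∈ Finset.range k, g i :=
  ⟨isBigO_sum_range hg h.1, isBigO_sum_range hf h.2⟩

theorem sum_range_two_mul_add_one (k : ℕ) :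
    ∑ i ∈ Finset.range k, (2 * (i : ℝ) + 1) = (k : ℝ) ^ 2 := by
  induction k with
  | zero => simp
  | succ k ih =>
    rw [Finset.sum_range_succ, ih]
    push_cast
    ring

theorem isTheta_two_mul_add_one :
    (fun k : ℕ => 2 * (k : ℝ) + 1) =Θ[atTop] fun k : ℕ => (k : ℝ) := by
  refine ⟨IsBigO.of_bound 3 ?_, IsBigO.of_bound 1 (Eventually.of_forall fun k => ?_)⟩
  · filter_upwards [eventually_ge_atTop 1] with k hk
    have hk' : (1 : ℝ) ≤ k := by exact_mod_cast hk
    rw [Real.norm_of_nonneg (by positivity), Real.norm_of_nonneg (by positivity)]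
    linarith
  · rw [Real.norm_of_nonneg (by positivity), Real.norm_of_nonneg (by positivity)]
    linarith [Nat.cast_nonneg (α := ℝ) k]

namespace StepSizeCondition

variable {L : ℝ} {A : ℕ → ℝ}

theorem isTheta_sq (hA : StepSizeCondition L A) : A =Θ[atTop] fun k : ℕ => (k : ℝ) ^ 2 := by
  have hsum := isTheta_sum_range hA.pos (fun k => by positivity)
    (hA.theta.trans isTheta_two_mul_add_one.symm)
  simpa only [sum_range_two_mul_add_one, stepDiff, Finset.sum_range_sub, hA.zero, sub_zero]
    using hsum

theorem tendsto_atTop (hA : StepSizeCondition L A) : Tendsto A atTop atTop := by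
  have hsq : Tendsto (fun k : ℕ => ‖(k : ℝ) ^ 2‖) atTop atTop :=
    tendsto_norm_atTop_atTop.comp
      ((tendsto_pow_atTop two_ne_zero).comp tendsto_natCast_atTop_atTop)
  refine (hA.isTheta_sq.tendsto_norm_atTop_iff.2 hsq).congr fun k => ?_
  exact Real.norm_of_nonneg (hA.nonneg k)

end StepSizeCondition

theorem isBigO_log_sub_log {α : Type*} {l : Filter α} {f g : α → ℝ} (h : f =Θ[l] g) :
    (fun x => Real.log (f x) - Real.log (g x)) =O[l] fun _ => (1 : ℝ) := by
  obtain ⟨C, hC, hfg⟩ := h.1.exists_pos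
  obtain ⟨D, hD, hgf⟩ := h.2.exists_pos
  refine IsBigO.of_bound (|Real.log C| + |Real.log D|) ?_
  filter_upwards [hfg.bound, hgf.bound] with x hfgx hgfx
  simp only [Real.norm_eq_abs, abs_one, mul_one] at hfgx hgfx ⊢
  rcases eq_or_ne (g x) 0 with hg | hg
  · have hf : f x = 0 := by simpa [hg] using hfgx
    simp only [hf, hg, sub_self, abs_zero]
    positivity
  have hf : f x ≠ 0 := fun hf => hg (by simpa [hf] using hgfx)
  have hg' := abs_pos.2 hg
  have hf' := abs_pos.2 hf
  have hup := Real.log_le_log hf' hfgx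
  have hlow := Real.log_le_log hg' hgfx
  rw [Real.log_mul hC.ne' hg'.ne', Real.log_abs, Real.log_abs] at hup
  rw [Real.log_mul hD.ne' hf'.ne', Real.log_abs, Real.log_abs] at hlow
  rw [abs_le]
  constructor <;>
    linarith [le_abs_self (Real.log C), le_abs_self (Real.log D), abs_nonneg (Real.log C),
      abs_nonneg (Real.log D)]

theorem isBigO_one_log_natCast :
    (fun _ : ℕ => (1 : ℝ)) =O[atTop] fun k : ℕ => Real.log k :=
  (isLittleO_const_left.2 (Or.inr (tendsto_norm_atTop_atTop.comp
    (Real.tendsto_log_atTop.comp tendsto_natCast_atTop_atTop)))).isBigO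

theorem isBigO_log_of_isTheta_sq {a : ℕ → ℝ} (ha : a =Θ[atTop] fun k : ℕ => (k : ℝ) ^ 2) :
    (fun k => Real.log (a k)) =O[atTop] fun k : ℕ => Real.log k := by
  have hsq : (fun k : ℕ => Real.log ((k : ℝ) ^ 2)) =O[atTop] fun k : ℕ => Real.log k := by
    simpa only [Real.log_pow] using (isBigO_refl (fun k : ℕ => Real.log k) atTop).const_mul_left _
  simpa using ((isBigO_log_sub_log ha).trans isBigO_one_log_natCast).add hsq

theorem isBigO_gpBound {m β φ : ℝ} (hm : m ≠ 0) (hβ : β ≠ 0) (hφ : φ ≠ 0) {A : ℕ → ℝ}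
    (hA : A =Θ[atTop] fun k : ℕ => (k : ℝ) ^ 2) :
    (fun k : ℕ => gpBound m β φ (A k)) =O[atTop] fun k : ℕ => Real.log k ^ 2 / (k : ℝ) ^ 2 := by
  have hprefactor : (fun k => 2 * m ^ 2 / (φ ^ 2 * A k)) =O[atTop] fun k : ℕ => ((k : ℝ) ^ 2)⁻¹ :=
    (hA.inv.isBigO.const_mul_left (2 * m ^ 2 / φ ^ 2)).congr_left fun k => by field_simp
  have hlog : (fun k => Real.log (β * φ ^ 2 * A k / m ^ 2)) =O[atTop] fun k : ℕ => Real.log k := by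
    refine isBigO_log_of_isTheta_sq ?_
    have hκ : β * φ ^ 2 / m ^ 2 ≠ 0 := by positivity
    simpa only [mul_div_right_comm] using hA.const_mul_left hκ
  have hbracket : (fun k => 1 + Real.log (β * φ ^ 2 * A k / m ^ 2) ^ 2) =O[atTop]
      fun k : ℕ => Real.log k ^ 2 := by
    simpa only [one_pow] using (isBigO_one_log_natCast.pow 2).add (hlog.pow 2)
  exact (hprefactor.mul hbracket).congr_right fun k => by rw [inv_mul_eq_div]

end Rate

section PolyhedralCone

open Module Submodule ProperCone

variable {E : Type*} [NormedAddCommGroup E] [InnerProductSpace ℝ E] {s : Set E} {x v : E}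

/-- The span of the constraints `0 ≤ ⟪a, ·⟫`, `a ∈ s`, of the dual cone of `s` that are tight
at `x`. -/
def tightSpan (s : Set E) (x : E) : Submodule ℝ E :=
  span ℝ {a ∈ s | inner ℝ a x = 0}

theorem tightSpan_le_span (s : Set E) (x : E) : tightSpan s x ≤ span ℝ s :=
  span_mono (Set.sep_subset _ _)

theorem tightSpan_le_orthogonal (s : Set E) (x : E) : tightSpan s x ≤ (ℝ ∙ x)ᗮ :=
  span_le.2 fun _ ha => mem_orthogonal_singleton_iff_inner_left.2 ha.2

theorem mem_orthogonal_tightSpan (s : Set E) (x : E) : x ∈ (tightSpan s x)ᗮ :=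
  fun _ ha => mem_orthogonal_singleton_iff_inner_left.1 (tightSpan_le_orthogonal s x ha)

theorem tightSpan_le_tightSpan_add_smul (hv : v ∈ (tightSpan s x)ᗮ) (t : ℝ) :
    tightSpan s x ≤ tightSpan s (x + t • v) := by
  refine span_mono fun a ha => ⟨ha.1, ?_⟩
  rw [inner_add_right, real_inner_smul_right, ha.2,
    inner_right_of_mem_orthogonal (subset_span ha) hv, mul_zero, add_zero]

theorem tightSpan_smul {t : ℝ} (ht : t ≠ 0) : tightSpan s (t • x) = tightSpan s x := by
  simp only [tightSpan, real_inner_smul_right, mul_eq_zero, ht, false_or]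

theorem exists_inner_ne_zero (hv : v ∈ span ℝ s) (hv₀ : v ≠ 0) : ∃ a ∈ s, inner ℝ a v ≠ 0 := by
  by_contra! h
  have hle : span ℝ s ≤ (ℝ ∙ v)ᗮ :=
    span_le.2 fun a ha => mem_orthogonal_singleton_iff_inner_left.2 (h a ha)
  exact hv₀ (inner_self_eq_zero.1 (mem_orthogonal_singleton_iff_inner_left.1 (hle hv)))

theorem finrank_tightSpan_lt (hs : s.Finite) (hx : x ∈ span ℝ s) (hx₀ : x ≠ 0) :
    finrank ℝ (tightSpan s x) < finrank ℝ (span ℝ s) := by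
  have := FiniteDimensional.span_of_finite ℝ hs
  exact finrank_lt_finrank_of_lt ((tightSpan_le_span s x).lt_of_not_ge fun hle =>
    hx₀ (inner_self_eq_zero.1 (mem_orthogonal_tightSpan s x x (hle hx))))

variable [CompleteSpace E]

/-- `v` is the unit vector of an extreme ray of the dual cone of `s`, taken inside `span ℝ s` so
that the cone has no lineality; the rank condition expresses extremality. -/
structure IsUnitRay (s : Set E) (v : E) : Prop where
  norm_eq_one : ‖v‖ = 1
  mem_span : v ∈ span ℝ s
  mem_innerDual : v ∈ innerDual s
  finrank_tightSpan_add_one : finrank ℝ (tightSpan s v) + 1 = finrank ℝ (span ℝ s)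

theorem IsUnitRay.ne_zero (hv : IsUnitRay s v) : v ≠ 0 :=
  norm_ne_zero_iff.1 (hv.norm_eq_one ▸ one_ne_zero)

-- Directions orthogonal to the tight constraints keep them tight; follow `v` up to the first
-- further constraint that it hits.
theorem exists_tightSpan_lt_add_smul (hs : s.Finite) (hx : x ∈ innerDual s)
    (hv : v ∈ (tightSpan s x)ᗮ) (hneg : ∃ a ∈ s, inner ℝ a v < 0) :
    ∃ t : ℝ, 0 ≤ t ∧ x + t • v ∈ innerDual s ∧ tightSpan s x < tightSpan s (x + t • v) := by
  rw [mem_innerDual] at hx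
  obtain ⟨b, ⟨hbs, hbv⟩, hmin⟩ := Set.exists_min_image {a ∈ s | inner ℝ a v < 0}
    (fun a => inner ℝ a x / -inner ℝ a v) (hs.subset (Set.sep_subset _ _)) hneg
  set t := inner ℝ b x / -inner ℝ b v with ht
  have ht₀ : 0 ≤ t := div_nonneg (hx hbs) (by linarith)
  have hb : inner ℝ b (x + t • v) = 0 := by
    rw [inner_add_right, real_inner_smul_right, ht, div_mul_eq_mul_div, div_neg,
      mul_div_cancel_right₀ _ hbv.ne, add_neg_cancel]
  refine ⟨t, ht₀, mem_innerDual.2 fun a ha => ?_, ?_⟩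
  · rw [inner_add_right, real_inner_smul_right]
    rcases lt_or_ge (inner ℝ a v) 0 with hav | hav
    · have := (le_div_iff₀ (by linarith)).1 (hmin a ⟨ha, hav⟩)
      linarith
    · exact add_nonneg (hx ha) (mul_nonneg ht₀ hav)
  · refine (tightSpan_le_tightSpan_add_smul hv t).lt_of_not_ge fun hle => hbv.ne ?_
    exact inner_right_of_mem_orthogonal (hle (subset_span ⟨hbs, hb⟩)) hv

theorem exists_tightSpan_lt (hs : s.Finite) (hx : x ∈ span ℝ s) (hx₀ : x ≠ 0)
    (hxs : x ∈ innerDual s) (hrank : finrank ℝ (tightSpan s x) + 1 ≠ finrank ℝ (span ℝ s)) :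
    ∃ y ∈ span ℝ s, y ≠ 0 ∧ y ∈ innerDual s ∧ tightSpan s x < tightSpan s y := by
  have := FiniteDimensional.span_of_finite ℝ hs
  set K := tightSpan s x ⊔ ℝ ∙ x
  have hKs : K ≤ span ℝ s := sup_le (tightSpan_le_span s x) ((span_singleton_le_iff_mem _ _).2 hx)
  have hne : Kᗮ ⊓ span ℝ s ≠ ⊥ := by
    intro hbot
    have hfin := finiteDimensional_of_le (tightSpan_le_span s x)
    have hK : finrank ℝ K ≤ finrank ℝ (tightSpan s x) + 1 :=
      (finrank_add_le_finrank_add_finrank _ _).trans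
        (Nat.add_le_add_left (finrank_span_singleton hx₀).le _)
    have hlt := finrank_tightSpan_lt hs hx hx₀
    have horth := finrank_add_inf_finrank_orthogonal hKs
    rw [hbot, finrank_bot] at horth
    omega
  obtain ⟨w, ⟨hwK, hws⟩, hw₀⟩ := exists_mem_ne_zero_of_ne_bot hne
  obtain ⟨v, hvs, hvK, hneg⟩ : ∃ v ∈ span ℝ s, v ∈ Kᗮ ∧ ∃ a ∈ s, inner ℝ a v < 0 := by
    obtain ⟨a, ha, haw⟩ := exists_inner_ne_zero hws hw₀
    rcases haw.lt_or_gt with haw | haw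
    · exact ⟨w, hws, hwK, a, ha, haw⟩
    · exact ⟨-w, neg_mem hws, neg_mem hwK, a, ha, by rwa [inner_neg_right, neg_lt_zero]⟩
  obtain ⟨t, -, hmem, hlt⟩ :=
    exists_tightSpan_lt_add_smul hs hxs (orthogonal_le le_sup_left hvK) hneg
  refine ⟨x + t • v, add_mem hx (smul_mem _ _ hvs), fun h₀ => hx₀ ?_, hmem, hlt⟩
  have hxv : inner ℝ x v = 0 :=
    mem_orthogonal_singleton_iff_inner_right.1 (orthogonal_le le_sup_right hvK)
  have hx_inner := congrArg (inner ℝ x) h₀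
  rwa [inner_add_right, real_inner_smul_right, hxv, mul_zero, add_zero, inner_zero_right,
    inner_self_eq_zero] at hx_inner

theorem exists_isUnitRay (hs : s.Finite) (hx : x ∈ span ℝ s) (hx₀ : x ≠ 0)
    (hxs : x ∈ innerDual s) : ∃ v, IsUnitRay s v ∧ tightSpan s x ≤ tightSpan s v := by
  have := FiniteDimensional.span_of_finite ℝ hs
  induction hd : finrank ℝ (span ℝ s) - finrank ℝ (tightSpan s x)
    using Nat.strong_induction_on generalizing x with
  | _ d ih =>
  have hlt := finrank_tightSpan_lt hs hx hx₀
  by_cases hrank : finrank ℝ (tightSpan s x) + 1 = finrank ℝ (span ℝ s)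
  · have hnorm : ‖x‖⁻¹ ≠ 0 := inv_ne_zero (norm_ne_zero_iff.2 hx₀)
    exact ⟨‖x‖⁻¹ • x, ⟨norm_smul_inv_norm hx₀, smul_mem _ _ hx,
      (innerDual s).smul_mem hxs (by positivity), by rwa [tightSpan_smul hnorm]⟩,
      (tightSpan_smul hnorm).ge⟩
  · obtain ⟨y, hy, hy₀, hys, hxy⟩ := exists_tightSpan_lt hs hx hx₀ hxs hrank
    have hle := tightSpan_le_span s y
    have hfin := finiteDimensional_of_le hle
    have := finrank_lt_finrank_of_lt hxy
    obtain ⟨v, hv, hyv⟩ := ih _ (by omega) hy hy₀ hys rfl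
    exact ⟨v, hv, hxy.le.trans hyv⟩

-- Subtracting an extreme ray on which all tight constraints of `x` vanish, until a further one
-- becomes tight, raises the rank of the tight constraints.
theorem exists_eq_sum_smul_isUnitRay (hs : s.Finite) (hx : x ∈ span ℝ s) (hxs : x ∈ innerDual s) :
    ∃ (k : ℕ) (t : Fin k → ℝ) (v : Fin k → E),
      k + finrank ℝ (tightSpan s x) ≤ finrank ℝ (span ℝ s) ∧
        (∀ i, 0 ≤ t i) ∧ (∀ i, IsUnitRay s (v i)) ∧ x = ∑ i, t i • v i := by
  have := FiniteDimensional.span_of_finite ℝ hs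
  induction hd : finrank ℝ (span ℝ s) - finrank ℝ (tightSpan s x)
    using Nat.strong_induction_on generalizing x with
  | _ d ih =>
  rcases eq_or_ne x 0 with rfl | hx₀
  · refine ⟨0, 0, 0, ?_, by simp, by simp, by simp⟩
    rw [zero_add]
    exact finrank_mono (tightSpan_le_span s 0)
  have hlt := finrank_tightSpan_lt hs hx hx₀
  obtain ⟨v₀, hv₀, htight⟩ := exists_isUnitRay hs hx hx₀ hxs
  obtain ⟨a, ha, hav⟩ := exists_inner_ne_zero hv₀.mem_span hv₀.ne_zero
  obtain ⟨t₀, ht₀, hmem, hxlt⟩ := exists_tightSpan_lt_add_smul (v := -v₀) hs hxs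
    (neg_mem (orthogonal_le htight (mem_orthogonal_tightSpan s v₀))) ⟨a, ha, by
      rw [inner_neg_right, neg_lt_zero]
      exact (mem_innerDual.1 hv₀.mem_innerDual ha).lt_of_ne' hav⟩
  have hfin := finiteDimensional_of_le (tightSpan_le_span s (x + t₀ • -v₀))
  have hrank := finrank_lt_finrank_of_lt hxlt
  obtain ⟨k, t, v, hk, ht, hv, hsum⟩ :=
    ih _ (by omega) (add_mem hx (smul_mem _ _ (neg_mem hv₀.mem_span))) hmem rfl
  refine ⟨k + 1, Fin.cons t₀ t, Fin.cons v₀ v, by omega, Fin.cases ht₀ ht, Fin.cases hv₀ hv, ?_⟩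
  rw [Fin.sum_univ_succ]
  simp only [Fin.cons_zero, Fin.cons_succ]
  rw [← hsum, smul_neg, add_comm, neg_add_cancel_right]

-- Truncate at `T` the coefficients of a decomposition of `x` into extreme rays: a constraint is
-- either tight along every truncated ray or already gains `φ * T` from a single one.
theorem exists_norm_le_sub_mem_innerDual (hs : s.Finite) {φ T : ℝ} (hT : 0 ≤ T)
    (hgap : ∀ v, IsUnitRay s v → ∀ a ∈ s, inner ℝ a v = 0 ∨ φ ≤ inner ℝ a v)
    (hx : x ∈ span ℝ s) (hxs : x ∈ innerDual s) :
    ∃ u : E, ‖u‖ ≤ finrank ℝ (span ℝ s) * T ∧ x - u ∈ innerDual s ∧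
      ∀ a ∈ s, inner ℝ a (x - u) = 0 ∨ φ * T ≤ inner ℝ a u := by
  obtain ⟨k, t, v, hk, ht, hv, rfl⟩ := exists_eq_sum_smul_isUnitRay hs hx hxs
  have hinner (a : E) (ha : a ∈ s) (i : Fin k) : 0 ≤ inner ℝ a (v i) :=
    mem_innerDual.1 (hv i).mem_innerDual ha
  have hmin (i : Fin k) : 0 ≤ min (t i) T := le_min (ht i) hT
  have hsub : ∑ i, t i • v i - ∑ i, min (t i) T • v i = ∑ i, (t i - min (t i) T) • v i := by
    simp only [sub_smul, Finset.sum_sub_distrib]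
  refine ⟨∑ i, min (t i) T • v i, ?_, ?_, fun a ha => ?_⟩
  · calc ‖∑ i, min (t i) T • v i‖ ≤ ∑ _i : Fin k, T := by
          refine norm_sum_le_of_le _ fun i _ => ?_
          rw [norm_smul, (hv i).norm_eq_one, mul_one, Real.norm_of_nonneg (hmin i)]
          exact min_le_right _ _
      _ = k * T := by simp
      _ ≤ finrank ℝ (span ℝ s) * T := by
          gcongr
          omega
  · rw [hsub, mem_innerDual]
    intro a ha
    simp only [inner_sum, real_inner_smul_right]
    exact Finset.sum_nonneg fun i _ =>
      mul_nonneg (sub_nonneg.2 (min_le_left _ _)) (hinner a ha i)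
  · rw [hsub]
    simp only [inner_sum, real_inner_smul_right]
    by_cases hshort : ∀ i, inner ℝ a (v i) = 0 ∨ t i ≤ T
    · refine Or.inl (Finset.sum_eq_zero fun i _ => ?_)
      rcases hshort i with h | h
      · rw [h, mul_zero]
      · rw [min_eq_left h, sub_self, zero_mul]
    · push Not at hshort
      obtain ⟨i, hi, hTi⟩ := hshort
      have hφ : φ ≤ inner ℝ a (v i) := (hgap _ (hv i) a ha).resolve_left hi
      refine Or.inr ?_
      calc φ * T ≤ inner ℝ a (v i) * T := by gcongr
        _ = min (t i) T * inner ℝ a (v i) := by rw [min_eq_right hTi.le, mul_comm]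
        _ ≤ ∑ j, min (t j) T * inner ℝ a (v j) :=
          Finset.single_le_sum (f := fun j => min (t j) T * inner ℝ a (v j))
            (fun j _ => mul_nonneg (hmin j) (hinner a ha j)) (Finset.mem_univ i)

theorem IsUnitRay.tightSpan_eq (hs : s.Finite) (hv : IsUnitRay s v) :
    tightSpan s v = (ℝ ∙ v)ᗮ ⊓ span ℝ s := by
  have := FiniteDimensional.span_of_finite ℝ hs
  refine eq_of_le_of_finrank_eq
    (le_inf (tightSpan_le_orthogonal s v) (tightSpan_le_span s v)) ?_
  have hcodim := finrank_add_inf_finrank_orthogonal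
    ((span_singleton_le_iff_mem v (span ℝ s)).2 hv.mem_span)
  rw [finrank_span_singleton hv.ne_zero, ← hv.finrank_tightSpan_add_one] at hcodim
  omega

end PolyhedralCone

section Faces

theorem subset_convexHull_inter_of_isExtreme {E : Type*} [AddCommGroup E] [Module ℝ E]
    {S F : Set E} (hF : IsExtreme ℝ (convexHull ℝ S) F) : F ⊆ convexHull ℝ (S ∩ F) := by
  have hconv : Convex ℝ {x ∈ convexHull ℝ S | x ∈ F → x ∈ convexHull ℝ (S ∩ F)} := by
    rw [convex_iff_openSegment_subset]
    rintro x ⟨hx, hxF⟩ y ⟨hy, hyF⟩ z hz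
    refine ⟨(convex_convexHull ℝ S).openSegment_subset hx hy hz, fun hzF => ?_⟩
    have hx' := hxF (hF.left_mem_of_mem_openSegment hx hy hzF hz)
    have hy' := hyF (hF.left_mem_of_mem_openSegment hy hx hzF (openSegment_symm ℝ x y ▸ hz))
    exact (convex_convexHull ℝ _).openSegment_subset hx' hy' hz
  have hsub : S ⊆ {x ∈ convexHull ℝ S | x ∈ F → x ∈ convexHull ℝ (S ∩ F)} :=
    fun x hx => ⟨subset_convexHull ℝ S hx, fun hxF => subset_convexHull ℝ _ ⟨hx, hxF⟩⟩
  exact fun x hx => (convexHull_min hsub hconv (hF.subset hx)).2 hx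

theorem affineSpan_inter_of_isExtreme {E : Type*} [AddCommGroup E] [Module ℝ E]
    {S F : Set E} (hF : IsExtreme ℝ (convexHull ℝ S) F) :
    affineSpan ℝ (S ∩ F) = affineSpan ℝ F :=
  le_antisymm (affineSpan_mono ℝ Set.inter_subset_right) (affineSpan_le.2
    ((subset_convexHull_inter_of_isExtreme hF).trans (convexHull_subset_affineSpan _)))

theorem inter_affineSpan_subset_of_isExposed {E : Type*} [TopologicalSpace E] [AddCommGroup E]
    [Module ℝ E] {P F : Set E} (hF : IsExposed ℝ P F) : P ∩ affineSpan ℝ F ⊆ F := by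
  rintro x ⟨hxP, hx⟩
  obtain ⟨p, hp⟩ : F.Nonempty := (affineSpan_nonempty ℝ).1 ⟨x, hx⟩
  obtain ⟨ℓ, rfl⟩ := hF ⟨p, hp⟩
  have hker : vectorSpan ℝ {q ∈ P | ∀ y ∈ P, ℓ y ≤ ℓ q} ≤ LinearMap.ker ℓ.toLinearMap := by
    refine Submodule.span_le.2 ?_
    rintro _ ⟨q, hq, r, hr, rfl⟩
    simp [le_antisymm (hr.2 q hq.1) (hq.2 r hr.1)]
  have hxp : ℓ (x - p) = 0 :=
    hker (vsub_mem_vectorSpan_of_mem_affineSpan_of_mem_affineSpan hx (mem_affineSpan ℝ hp))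
  rw [map_sub, sub_eq_zero] at hxp
  exact ⟨hxP, fun y hy => hxp ▸ hp.2 y hy⟩

end Faces

section NewtonPolytope

open ProperCone

variable {n N : ℕ} {ω : Fin N → Vec n} {i₀ : Fin N}

theorem mem_newtonPolytope (ω : Fin N → Vec n) (l : Fin N) : ω l ∈ newtonPolytope ω :=
  subset_convexHull ℝ _ (Set.mem_range_self l)

theorem exists_inner_le_of_mem_newtonPolytope {p : Vec n} (hp : p ∈ newtonPolytope ω)
    (x : Vec n) : ∃ l, inner ℝ p x ≤ inner ℝ (ω l) x := by
  have hconvex : ConvexOn ℝ Set.univ (innerSL ℝ x) :=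
    (innerSL ℝ x).toLinearMap.convexOn convex_univ
  obtain ⟨_, ⟨l, rfl⟩, hl⟩ := hconvex.exists_ge_of_mem_convexHull (Set.subset_univ _) hp
  exact ⟨l, by simpa only [innerSL_apply_apply, real_inner_comm x] using hl⟩

theorem affDim_newtonPolytope (ω : Fin N → Vec n) :
    affDim (newtonPolytope ω) = affDim (Set.range ω) := by
  rw [affDim, affDim, newtonPolytope, ← direction_affineSpan, affineSpan_convexHull,
    direction_affineSpan]

/-- The differences `ω i₀ - ω l`. Their dual cone consists of the `x` at which `⟪ω l, x⟫` is
maximal for `l = i₀`, that is, it is the normal cone of the Newton polytope at `ω i₀`. -/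
def vertexDiffs (ω : Fin N → Vec n) (i₀ : Fin N) : Set (Vec n) :=
  Set.range fun l => ω i₀ - ω l

theorem finite_vertexDiffs (ω : Fin N → Vec n) (i₀ : Fin N) : (vertexDiffs ω i₀).Finite :=
  Set.finite_range _

theorem span_vertexDiffs (ω : Fin N → Vec n) (i₀ : Fin N) :
    Submodule.span ℝ (vertexDiffs ω i₀) = vectorSpan ℝ (Set.range ω) :=
  (vectorSpan_range_eq_span_range_vsub_left ℝ ω i₀).symm

theorem exists_mem_innerDual_vertexDiffs [Nonempty (Fin N)] (ω : Fin N → Vec n) (x : Vec n) :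
    ∃ i₀, x ∈ innerDual (vertexDiffs ω i₀) := by
  obtain ⟨i₀, hi₀⟩ := Finite.exists_max fun l => inner ℝ (ω l) x
  refine ⟨i₀, mem_innerDual.2 ?_⟩
  rintro _ ⟨l, rfl⟩
  rw [inner_sub_left]
  exact sub_nonneg.2 (hi₀ l)

theorem inner_sub_nonneg_of_mem_newtonPolytope {p x : Vec n} (hp : p ∈ newtonPolytope ω)
    (hx : x ∈ innerDual (vertexDiffs ω i₀)) : 0 ≤ inner ℝ (ω i₀ - p) x := by
  obtain ⟨l, hl⟩ := exists_inner_le_of_mem_newtonPolytope hp x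
  have hi₀ := mem_innerDual.1 hx (Set.mem_range_self l)
  rw [inner_sub_left] at hi₀ ⊢
  linarith

theorem mem_toExposed_newtonPolytope_iff {v : Vec n} (hv : v ∈ innerDual (vertexDiffs ω i₀))
    (l : Fin N) : ω l ∈ (innerSL ℝ v).toExposed (newtonPolytope ω) ↔
      inner ℝ (ω i₀ - ω l) v = 0 := by
  have hmax (q : Vec n) (hq : q ∈ newtonPolytope ω) : inner ℝ v q ≤ inner ℝ v (ω i₀) := by
    have h := inner_sub_nonneg_of_mem_newtonPolytope hq hv
    rwa [inner_sub_left, sub_nonneg, real_inner_comm, real_inner_comm _ (ω i₀)] at h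
  rw [real_inner_comm, inner_sub_right, sub_eq_zero]
  exact ⟨fun h => le_antisymm (h.2 _ (mem_newtonPolytope ω i₀)) (hmax _ h.1),
    fun h => ⟨mem_newtonPolytope ω l, fun q hq => (hmax q hq).trans_eq h⟩⟩

theorem mem_toExposed_newtonPolytope {v : Vec n} (hv : v ∈ innerDual (vertexDiffs ω i₀)) :
    ω i₀ ∈ (innerSL ℝ v).toExposed (newtonPolytope ω) :=
  (mem_toExposed_newtonPolytope_iff hv i₀).2 (by rw [sub_self, inner_zero_left])

theorem vectorSpan_toExposed_newtonPolytope {v : Vec n}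
    (hv : v ∈ innerDual (vertexDiffs ω i₀)) :
    vectorSpan ℝ ((innerSL ℝ v).toExposed (newtonPolytope ω)) = tightSpan (vertexDiffs ω i₀) v := by
  set F := (innerSL ℝ v).toExposed (newtonPolytope ω)
  have hF : IsExtreme ℝ (newtonPolytope ω) F := ContinuousLinearMap.toExposed.isExposed.isExtreme
  have himage : (ω i₀ - ·) '' (Set.range ω ∩ F) = {a ∈ vertexDiffs ω i₀ | inner ℝ a v = 0} := by
    ext a
    constructor
    · rintro ⟨_, ⟨⟨l, rfl⟩, hl⟩, rfl⟩
      exact ⟨⟨l, rfl⟩, (mem_toExposed_newtonPolytope_iff hv l).1 hl⟩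
    · rintro ⟨⟨l, rfl⟩, hl⟩
      exact ⟨ω l, ⟨⟨l, rfl⟩, (mem_toExposed_newtonPolytope_iff hv l).2 hl⟩, rfl⟩
  have hmem : ω i₀ ∈ Set.range ω ∩ F := ⟨Set.mem_range_self i₀, mem_toExposed_newtonPolytope hv⟩
  rw [← direction_affineSpan, ← affineSpan_inter_of_isExtreme hF, direction_affineSpan,
    vectorSpan_eq_span_vsub_set_left ℝ hmem, tightSpan, ← himage]
  rfl

theorem IsUnitRay.isFacet {v : Vec n} (hv : IsUnitRay (vertexDiffs ω i₀) v) :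
    IsFacet (newtonPolytope ω) ((innerSL ℝ v).toExposed (newtonPolytope ω)) := by
  refine ⟨ContinuousLinearMap.toExposed.isExposed,
    ⟨ω i₀, mem_toExposed_newtonPolytope hv.mem_innerDual⟩, ?_⟩
  rw [affDim_newtonPolytope, affDim, affDim, vectorSpan_toExposed_newtonPolytope hv.mem_innerDual,
    ← span_vertexDiffs ω i₀, hv.finrank_tightSpan_add_one]

theorem facetGap_le_infDist {F : Set (Vec n)} (hF : IsFacet (newtonPolytope ω) F) {l : Fin N}
    (hl : ω l ∉ F) : facetGap ω ≤ Metric.infDist (ω l) (affineSpan ℝ F : Set (Vec n)) := by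
  refine csInf_le ⟨0, ?_⟩ ⟨l, F, hF, hl, rfl⟩
  rintro _ ⟨_, _, _, _, rfl⟩
  exact Metric.infDist_nonneg

theorem IsUnitRay.inner_eq_zero_or_facetGap_le {v a : Vec n}
    (hv : IsUnitRay (vertexDiffs ω i₀) v) (ha : a ∈ vertexDiffs ω i₀) :
    inner ℝ a v = 0 ∨ facetGap ω ≤ inner ℝ a v := by
  refine or_iff_not_imp_left.2 fun hav => ?_
  have hav₀ : 0 ≤ inner ℝ a v := ProperCone.mem_innerDual.1 hv.mem_innerDual ha
  set F := (innerSL ℝ v).toExposed (newtonPolytope ω) with hF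
  have hproj : a - inner ℝ a v • v ∈ vectorSpan ℝ F := by
    rw [hF, vectorSpan_toExposed_newtonPolytope hv.mem_innerDual,
      hv.tightSpan_eq (finite_vertexDiffs ω i₀)]
    refine ⟨Submodule.mem_orthogonal_singleton_iff_inner_left.2 ?_,
      Submodule.sub_mem _ (Submodule.subset_span ha) (Submodule.smul_mem _ _ hv.mem_span)⟩
    rw [inner_sub_left, real_inner_smul_left, real_inner_self_eq_norm_sq, hv.norm_eq_one]
    ring
  obtain ⟨l, rfl⟩ := ha
  set d := inner ℝ (ω i₀ - ω l) v
  have hmem : ω l + d • v ∈ affineSpan ℝ F := by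
    have h := AffineSubspace.vadd_mem_of_mem_direction (s := affineSpan ℝ F)
      (direction_affineSpan ℝ F ▸ neg_mem hproj)
      (mem_affineSpan ℝ (mem_toExposed_newtonPolytope hv.mem_innerDual))
    rwa [vadd_eq_add, show -(ω i₀ - ω l - d • v) + ω i₀ = ω l + d • v by abel] at h
  calc facetGap ω ≤ Metric.infDist (ω l) (affineSpan ℝ F : Set (Vec n)) :=
        facetGap_le_infDist hv.isFacet fun h =>
          hav ((mem_toExposed_newtonPolytope_iff hv.mem_innerDual l).1 h)
    _ ≤ dist (ω l) (ω l + d • v) := Metric.infDist_le_dist_of_mem hmem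
    _ = d := by
        rw [dist_self_add_right, norm_smul, hv.norm_eq_one, mul_one, Real.norm_of_nonneg hav₀]

theorem exists_isFacet_notMem (hω : ∃ i j, ω i ≠ ω j) :
    ∃ F l, IsFacet (newtonPolytope ω) F ∧ ω l ∉ F := by
  obtain ⟨i, j, hij⟩ := hω
  have : Nonempty (Fin N) := ⟨i⟩
  obtain ⟨i₀, hi₀⟩ := exists_mem_innerDual_vertexDiffs ω (ω i - ω j)
  have hmem : ω i - ω j ∈ Submodule.span ℝ (vertexDiffs ω i₀) := by
    rw [span_vertexDiffs]
    exact vsub_mem_vectorSpan ℝ (Set.mem_range_self i) (Set.mem_range_self j)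
  obtain ⟨v, hv, -⟩ := exists_isUnitRay (finite_vertexDiffs ω i₀) hmem (sub_ne_zero.2 hij) hi₀
  obtain ⟨_, ⟨l, rfl⟩, hl⟩ := exists_inner_ne_zero hv.mem_span hv.ne_zero
  exact ⟨_, l, hv.isFacet, fun h => hl ((mem_toExposed_newtonPolytope_iff hv.mem_innerDual l).1 h)⟩

theorem IsFacet.infDist_pos {F : Set (Vec n)} (hF : IsFacet (newtonPolytope ω) F) {l : Fin N}
    (hl : ω l ∉ F) : 0 < Metric.infDist (ω l) (affineSpan ℝ F : Set (Vec n)) :=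
  ((AffineSubspace.closed_of_finiteDimensional _).notMem_iff_infDist_pos
    (hF.2.1.mono (subset_affineSpan ℝ F))).1 fun hmem =>
      hl (inter_affineSpan_subset_of_isExposed hF.1 ⟨mem_newtonPolytope ω l, hmem⟩)

theorem facetGap_pos (hω : ∃ i j, ω i ≠ ω j) : 0 < facetGap ω := by
  set S := {d : ℝ | ∃ (l : Fin N) (F : Set (Vec n)), IsFacet (newtonPolytope ω) F ∧ ω l ∉ F ∧
    d = Metric.infDist (ω l) (affineSpan ℝ F : Set (Vec n))}
  have hfin : S.Finite := by
    refine ((Set.finite_univ (α := Fin N)).image2 (fun l (Ω : Set (Vec n)) =>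
      Metric.infDist (ω l) (affineSpan ℝ Ω : Set (Vec n)))
      (Set.finite_range ω).powerset).subset ?_
    rintro _ ⟨l, F, hF, -, rfl⟩
    exact ⟨l, Set.mem_univ l, Set.range ω ∩ F, Set.inter_subset_left,
      by simp only [affineSpan_inter_of_isExtreme hF.1.isExtreme]⟩
  have hne : S.Nonempty := by
    obtain ⟨F, l, hF, hl⟩ := exists_isFacet_notMem hω
    exact ⟨_, l, F, hF, hl, rfl⟩
  obtain ⟨l, F, hF, hl, hmin⟩ := hne.csInf_mem hfin
  exact (hF.infDist_pos hl).trans_eq hmin.symm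

end NewtonPolytope

section WeightedSums

variable {ι : Type*} [Fintype ι] {w : ι → ℝ}

theorem sum_mul_sub_sum_sq_le (hw : ∑ i, w i = 1) (b : ι → ℝ) :
    ∑ i, w i * (b i - ∑ j, w j * b j) ^ 2 ≤ ∑ i, w i * b i ^ 2 := by
  set μ := ∑ j, w j * b j with hμ
  have hvar : ∑ i, w i * (b i - μ) ^ 2 = ∑ i, w i * b i ^ 2 - μ ^ 2 := by
    have hterm (i : ι) :
        w i * (b i - μ) ^ 2 = w i * b i ^ 2 - 2 * μ * (w i * b i) + μ ^ 2 * w i := by ring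
    simp only [hterm, Finset.sum_add_distrib, Finset.sum_sub_distrib, ← Finset.mul_sum, ← hμ, hw]
    ring
  exact hvar.trans_le (sub_le_self _ (sq_nonneg μ))

variable {E : Type*} [NormedAddCommGroup E] [InnerProductSpace ℝ E] {v : ι → E} {L : ℝ}

theorem norm_covariance_le (hw₀ : ∀ i, 0 ≤ w i) (hw : ∑ i, w i = 1) (hv : ∀ i, ‖v i‖ ^ 2 ≤ L)
    (d : E) :
    ‖∑ i, (w i * (inner ℝ (v i) d - inner ℝ (∑ j, w j • v j) d)) • v i‖ ≤ L * ‖d‖ := by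
  have hmean (r : ι → ℝ) {M : ℝ} (hr : ∀ i, r i ≤ M) : ∑ i, w i * r i ≤ M :=
    (Finset.sum_le_sum fun i _ => mul_le_mul_of_nonneg_left (hr i) (hw₀ i)).trans_eq
      (by rw [← Finset.sum_mul, hw, one_mul])
  have hL : 0 ≤ L := (Finset.sum_nonneg fun i _ => mul_nonneg (hw₀ i) (sq_nonneg ‖v i‖)).trans
    (hmean _ hv)
  set μ := inner ℝ (∑ j, w j • v j) d with hμ
  have hvar : ∑ i, w i * (inner ℝ (v i) d - μ) ^ 2 ≤ L * ‖d‖ ^ 2 := by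
    have h := sum_mul_sub_sum_sq_le hw fun i => inner ℝ (v i) d
    simp only [← real_inner_smul_left, ← sum_inner, ← hμ] at h
    refine h.trans (hmean _ fun i => ?_)
    calc inner ℝ (v i) d ^ 2 ≤ (‖v i‖ * ‖d‖) ^ 2 := sq_le_sq.2
          ((abs_real_inner_le_norm _ _).trans (le_abs_self _))
      _ = ‖v i‖ ^ 2 * ‖d‖ ^ 2 := mul_pow _ _ _
      _ ≤ L * ‖d‖ ^ 2 := mul_le_mul_of_nonneg_right (hv i) (sq_nonneg _)
  have hnorm : ‖∑ i, (w i * (inner ℝ (v i) d - μ)) • v i‖ ≤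
      ∑ i, w i * |inner ℝ (v i) d - μ| * ‖v i‖ :=
    (norm_sum_le _ _).trans_eq (Finset.sum_congr rfl fun i _ => by
      rw [norm_smul, norm_mul, Real.norm_of_nonneg (hw₀ i), Real.norm_eq_abs])
  refine hnorm.trans (le_of_sq_le_sq ?_ (by positivity))
  calc (∑ i, w i * |inner ℝ (v i) d - μ| * ‖v i‖) ^ 2
      ≤ (∑ i, w i * (inner ℝ (v i) d - μ) ^ 2) * ∑ i, w i * ‖v i‖ ^ 2 :=
        Finset.sum_sq_le_sum_mul_sum_of_sq_le_mul _
          (fun i _ => mul_nonneg (hw₀ i) (sq_nonneg _))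
          (fun i _ => mul_nonneg (hw₀ i) (sq_nonneg _))
          fun i _ => by rw [mul_pow, mul_pow, sq_abs]; exact le_of_eq (by ring)
    _ ≤ L * ‖d‖ ^ 2 * L := mul_le_mul hvar (hmean _ hv)
        (Finset.sum_nonneg fun i _ => mul_nonneg (hw₀ i) (sq_nonneg _)) (by positivity)
    _ = (L * ‖d‖) ^ 2 := by ring

end WeightedSums

section GeometricProgramming

variable {n N : ℕ} {c : Fin N → ℝ} {ω : Fin N → Vec n}

theorem sum_mul_exp_inner_pos [Nonempty (Fin N)] (hc : ∀ l, 0 < c l) (ω : Fin N → Vec n)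
    (x : Vec n) : 0 < ∑ l, c l * Real.exp (inner ℝ (ω l) x) :=
  Finset.sum_pos (fun l _ => mul_pos (hc l) (Real.exp_pos _)) Finset.univ_nonempty

theorem tilt_gpObjective [Nonempty (Fin N)] (hc : ∀ l, 0 < c l) (ω : Fin N → Vec n)
    (p : Vec n) : tilt (gpObjective c ω) p = gpObjective c fun l => ω l - p := by
  ext x
  simp only [tilt, gpObjective, inner_sub_left, Real.exp_sub, ← mul_div_assoc]
  rw [← Finset.sum_div, Real.log_div (sum_mul_exp_inner_pos hc ω x).ne' (Real.exp_pos _).ne',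
    Real.log_exp]

theorem exp_gpObjective [Nonempty (Fin N)] (hc : ∀ l, 0 < c l) (ω : Fin N → Vec n)
    (x : Vec n) : Real.exp (gpObjective c ω x) = ∑ l, c l * Real.exp (inner ℝ (ω l) x) :=
  Real.exp_log (sum_mul_exp_inner_pos hc ω x)

theorem sum_mul_exp_inner_sub [Nonempty (Fin N)] (hc : ∀ l, 0 < c l) (ω : Fin N → Vec n)
    (x : Vec n) (r : ℝ) :
    ∑ l, c l * Real.exp (inner ℝ (ω l) x - r) = Real.exp (gpObjective c ω x - r) := by
  simp only [Real.exp_sub, exp_gpObjective hc, Finset.sum_div, mul_div_assoc]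

/-- The Gibbs weights `c_ℓ exp ⟨ω_ℓ, x⟩ / ∑_j c_j exp ⟨ω_j, x⟩`, the denominator being written as
`exp (f x)`. -/
noncomputable def gpWeight (c : Fin N → ℝ) (ω : Fin N → Vec n) (x : Vec n) (l : Fin N) : ℝ :=
  c l * Real.exp (inner ℝ (ω l) x - gpObjective c ω x)

/-- The mean of the exponents under the Gibbs weights. It is the gradient of the objective. -/
noncomputable def gpMean (c : Fin N → ℝ) (ω : Fin N → Vec n) (x : Vec n) : Vec n :=
  ∑ l, gpWeight c ω x l • ω l

theorem gpWeight_pos (hc : ∀ l, 0 < c l) (x : Vec n) (l : Fin N) : 0 < gpWeight c ω x l :=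
  mul_pos (hc l) (Real.exp_pos _)

theorem sum_gpWeight [Nonempty (Fin N)] (hc : ∀ l, 0 < c l) (x : Vec n) :
    ∑ l, gpWeight c ω x l = 1 := by
  simp only [gpWeight, sum_mul_exp_inner_sub hc, sub_self, Real.exp_zero]

theorem hasGradientAt_gpObjective [Nonempty (Fin N)] (hc : ∀ l, 0 < c l) (x : Vec n) :
    HasGradientAt (gpObjective c ω) (gpMean c ω x) x := by
  have hsum : HasFDerivAt (fun x => ∑ l, c l * Real.exp (inner ℝ (ω l) x))
      (∑ l, (c l * Real.exp (inner ℝ (ω l) x)) • innerSL ℝ (ω l)) x := by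
    refine HasFDerivAt.fun_sum fun l _ => ?_
    simpa only [smul_smul, innerSL_apply_apply] using
      ((innerSL ℝ (ω l)).hasFDerivAt (x := x)).exp.const_mul (c l)
  rw [hasGradientAt_iff_hasFDerivAt]
  refine (hsum.log (sum_mul_exp_inner_pos hc ω x).ne').congr_fderiv ?_
  rw [← exp_gpObjective hc, Finset.smul_sum, gpMean, map_sum]
  refine Finset.sum_congr rfl fun l _ => ?_
  rw [map_smul, smul_smul, gpWeight, Real.exp_sub, mul_div_assoc', inv_mul_eq_div]
  rfl

theorem gradient_gpObjective [Nonempty (Fin N)] (hc : ∀ l, 0 < c l) :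
    gradient (gpObjective c ω) = gpMean c ω :=
  funext fun x => (hasGradientAt_gpObjective hc x).gradient

theorem gpObjective_add_inner_gpMean_le [Nonempty (Fin N)] (hc : ∀ l, 0 < c l) (x y : Vec n) :
    gpObjective c ω x + inner ℝ (gpMean c ω x) (y - x) ≤ gpObjective c ω y := by
  have hjensen := convexOn_exp.map_sum_le (t := Finset.univ) (w := gpWeight c ω x)
    (p := fun l => inner ℝ (ω l) (y - x)) (fun l _ => (gpWeight_pos hc x l).le)
    (sum_gpWeight hc x) (fun l _ => Set.mem_univ _)
  have hmean : ∑ l, gpWeight c ω x l • inner ℝ (ω l) (y - x) = inner ℝ (gpMean c ω x) (y - x) := by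
    simp only [gpMean, sum_inner, real_inner_smul_left, smul_eq_mul]
  have hexp : ∑ l, gpWeight c ω x l • Real.exp (inner ℝ (ω l) (y - x)) =
      Real.exp (gpObjective c ω y - gpObjective c ω x) := by
    rw [← sum_mul_exp_inner_sub hc]
    refine Finset.sum_congr rfl fun l _ => ?_
    rw [gpWeight, smul_eq_mul, mul_assoc, ← Real.exp_add, inner_sub_right]
    ring_nf
  rw [hmean, hexp, Real.exp_le_exp] at hjensen
  linarith

theorem hasDerivAt_gpMean_add_smul [Nonempty (Fin N)] (hc : ∀ l, 0 < c l) (x d : Vec n)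
    (t : ℝ) :
    HasDerivAt (fun t : ℝ => gpMean c ω (x + t • d)) (∑ l, (gpWeight c ω (x + t • d) l *
      (inner ℝ (ω l) d - inner ℝ (gpMean c ω (x + t • d)) d)) • ω l) t := by
  refine HasDerivAt.fun_sum fun l _ => HasDerivAt.smul_const ?_ _
  have hinner : HasDerivAt (fun t : ℝ => inner ℝ (ω l) (x + t • d)) (inner ℝ (ω l) d) t := by
    simp only [inner_add_right, real_inner_smul_right]
    exact ((hasDerivAt_id t).mul_const _).const_add _ |>.congr_deriv (one_mul _)
  have hobjective := hasDerivAt_add_smul_of_hasGradientAt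
    (hasGradientAt_gpObjective (ω := ω) hc (x + t • d))
  exact ((hinner.sub hobjective).exp.const_mul (c l)).congr_deriv (mul_assoc _ _ _).symm

theorem norm_sq_le_gpSmoothness (ω : Fin N → Vec n) (l : Fin N) : ‖ω l‖ ^ 2 ≤ gpSmoothness ω :=
  le_ciSup (f := fun l => ‖ω l‖ ^ 2) (Set.finite_range _).bddAbove l

theorem gpSmoothness_pos (hω : ∃ i j, ω i ≠ ω j) : 0 < gpSmoothness ω := by
  obtain ⟨i, j, hij⟩ := hω
  by_contra! h
  have hzero (l : Fin N) : ω l = 0 := by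
    have hle : ‖ω l‖ ^ 2 ≤ 0 := (norm_sq_le_gpSmoothness ω l).trans h
    simpa using le_antisymm hle (sq_nonneg _)
  exact hij ((hzero i).trans (hzero j).symm)

theorem isSmoothConvex_gpObjective (hc : ∀ l, 0 < c l) (hω : ∃ i j, ω i ≠ ω j) :
    IsSmoothConvex (gpSmoothness ω) (gpObjective c ω) := by
  have : Nonempty (Fin N) := hω.nonempty
  refine ⟨gpSmoothness_pos hω, ?_, fun x => (hasGradientAt_gpObjective hc x).differentiableAt,
    fun y x => ?_⟩
  · exact convexOn_of_forall_exists_add_inner_le convex_univ fun x _ =>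
      ⟨gpMean c ω x, fun y _ => gpObjective_add_inner_gpMean_le hc x y⟩
  · rw [gradient_gpObjective hc]
    simpa using norm_image_sub_le_of_norm_deriv_le_segment_01'
      (fun t _ => (hasDerivAt_gpMean_add_smul hc x (y - x) t).hasDerivWithinAt)
      fun t _ => norm_covariance_le (fun l => (gpWeight_pos hc _ l).le) (sum_gpWeight hc _)
        (norm_sq_le_gpSmoothness ω) _

theorem iInf_coeff_pos [Nonempty (Fin N)] (hc : ∀ l, 0 < c l) : 0 < ⨅ l, c l := by
  obtain ⟨j, hj⟩ := exists_eq_ciInf_of_finite (f := c)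
  exact hj ▸ hc j

theorem gpBeta_pos [Nonempty (Fin N)] (hc : ∀ l, 0 < c l) : 0 < gpBeta c :=
  div_pos (Finset.sum_pos (fun l _ => hc l) Finset.univ_nonempty) (iInf_coeff_pos hc)

theorem iInf_mul_exp_inner_le_exp_gpObjective (hc : ∀ l, 0 < c l) (ω : Fin N → Vec n)
    (x : Vec n) (i : Fin N) :
    (⨅ l, c l) * Real.exp (inner ℝ (ω i) x) ≤ Real.exp (gpObjective c ω x) := by
  have : Nonempty (Fin N) := ⟨i⟩
  rw [exp_gpObjective hc]
  refine (mul_le_mul_of_nonneg_right (ciInf_le (Set.finite_range c).bddBelow i)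
    (Real.exp_pos _).le).trans ?_
  exact Finset.single_le_sum (f := fun l => c l * Real.exp (inner ℝ (ω l) x))
    (fun l _ => (mul_pos (hc l) (Real.exp_pos _)).le) (Finset.mem_univ i)

theorem gpObjective_le_log_sum_add [Nonempty (Fin N)] (hc : ∀ l, 0 < c l) {x : Vec n} {r : ℝ}
    (hr : ∀ l, inner ℝ (ω l) x ≤ r) : gpObjective c ω x ≤ Real.log (∑ l, c l) + r := by
  rw [← Real.exp_le_exp, exp_gpObjective hc, Real.exp_add,
    Real.exp_log (Finset.sum_pos (fun l _ => hc l) Finset.univ_nonempty), Finset.sum_mul]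
  exact Finset.sum_le_sum fun l _ =>
    mul_le_mul_of_nonneg_left (Real.exp_le_exp.2 (hr l)) (hc l).le

theorem bddBelow_range_tilt_gpObjective [Nonempty (Fin N)] (hc : ∀ l, 0 < c l) {p : Vec n}
    (hp : p ∈ newtonPolytope ω) : BddBelow (Set.range (tilt (gpObjective c ω) p)) := by
  refine ⟨Real.log (⨅ l, c l), ?_⟩
  rintro _ ⟨x, rfl⟩
  obtain ⟨l, hl⟩ := exists_inner_le_of_mem_newtonPolytope hp x
  have hexp : 1 ≤ Real.exp (inner ℝ (ω l - p) x) :=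
    Real.one_le_exp (by rwa [inner_sub_left, sub_nonneg])
  rw [tilt_gpObjective hc, Real.log_le_iff_le_exp (iInf_coeff_pos hc)]
  exact (le_mul_of_one_le_right (iInf_coeff_pos hc).le hexp).trans
    (iInf_mul_exp_inner_le_exp_gpObjective hc (fun l => ω l - p) x l)

theorem conjugateDomain_gpObjective [Nonempty (Fin N)] (hc : ∀ l, 0 < c l) :
    conjugateDomain (gpObjective c ω) = newtonPolytope ω := by
  refine Set.Subset.antisymm (fun p hp => ?_) fun p hp =>
    mem_conjugateDomain_iff.2 (bddBelow_range_tilt_gpObjective hc hp)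
  obtain ⟨B, hB⟩ := mem_conjugateDomain_iff.1 hp
  by_contra hpP
  obtain ⟨ℓ, s, hs, hsp⟩ := geometric_hahn_banach_closed_point (convex_convexHull ℝ _)
    ((Set.finite_range ω).isClosed_convexHull ℝ) hpP
  set d := (InnerProductSpace.toDual ℝ (Vec n)).symm ℓ with hd
  have hinner (q : Vec n) : inner ℝ q d = ℓ q := by
    rw [real_inner_comm, hd, InnerProductSpace.toDual_symm_apply]
  obtain ⟨k, hk⟩ := exists_nat_gt ((Real.log (∑ l, c l) - B) / (ℓ p - s))
  rw [div_lt_iff₀ (sub_pos.2 hsp)] at hk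
  have hdescent : tilt (gpObjective c ω) p ((k : ℝ) • d) ≤
      Real.log (∑ l, c l) + k * (s - ℓ p) := by
    rw [tilt_gpObjective hc]
    refine gpObjective_le_log_sum_add hc fun l => ?_
    rw [real_inner_smul_right, inner_sub_left, hinner, hinner]
    exact mul_le_mul_of_nonneg_left (sub_le_sub_right (hs _ (mem_newtonPolytope ω l)).le _)
      k.cast_nonneg
  linarith [hB (Set.mem_range_self ((k : ℝ) • d))]

theorem closure_conjugateDomain_gpObjective [Nonempty (Fin N)] (hc : ∀ l, 0 < c l) :
    closure (conjugateDomain (gpObjective c ω)) = newtonPolytope ω := by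
  rw [conjugateDomain_gpObjective hc]
  exact ((Set.finite_range ω).isClosed_convexHull ℝ).closure_eq

theorem gpObjective_le_add_gpBeta_mul_exp (hc : ∀ l, 0 < c l) {x u : Vec n} {i : Fin N} {r : ℝ}
    (h : ∀ l, inner ℝ (ω l) u ≤ inner ℝ (ω l) x ∨ inner ℝ (ω l) u ≤ inner ℝ (ω i) x - r) :
    gpObjective c ω u ≤ gpObjective c ω x + gpBeta c * Real.exp (-r) := by
  have : Nonempty (Fin N) := ⟨i⟩
  have hmin := iInf_coeff_pos hc
  have hexp (l : Fin N) : Real.exp (inner ℝ (ω l) u) ≤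
      Real.exp (inner ℝ (ω l) x) + Real.exp (inner ℝ (ω i) x - r) := by
    rcases h l with h | h
    · exact (Real.exp_le_exp.2 h).trans (le_add_of_nonneg_right (Real.exp_pos _).le)
    · exact (Real.exp_le_exp.2 h).trans (le_add_of_nonneg_left (Real.exp_pos _).le)
  rw [← Real.exp_le_exp]
  calc Real.exp (gpObjective c ω u)
      ≤ ∑ l, c l * (Real.exp (inner ℝ (ω l) x) + Real.exp (inner ℝ (ω i) x - r)) := by
        rw [exp_gpObjective hc]
        exact Finset.sum_le_sum fun l _ => mul_le_mul_of_nonneg_left (hexp l) (hc l).le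
    _ = Real.exp (gpObjective c ω x) +
          gpBeta c * Real.exp (-r) * ((⨅ l, c l) * Real.exp (inner ℝ (ω i) x)) := by
        simp only [mul_add, Finset.sum_add_distrib, ← Finset.sum_mul, ← exp_gpObjective hc]
        rw [sub_eq_add_neg, Real.exp_add, gpBeta]
        field_simp
    _ ≤ Real.exp (gpObjective c ω x) +
          gpBeta c * Real.exp (-r) * Real.exp (gpObjective c ω x) :=
        add_le_add_right (mul_le_mul_of_nonneg_left
          (iInf_mul_exp_inner_le_exp_gpObjective hc ω x i)
          (mul_nonneg (gpBeta_pos hc).le (Real.exp_pos _).le)) _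
    _ = Real.exp (gpObjective c ω x) * (gpBeta c * Real.exp (-r) + 1) := by ring
    _ ≤ Real.exp (gpObjective c ω x + gpBeta c * Real.exp (-r)) := by
        rw [Real.exp_add]
        exact mul_le_mul_of_nonneg_left (Real.add_one_le_exp _) (Real.exp_pos _).le

theorem exists_forall_inner_le_or_le_sub [Nonempty (Fin N)] {p : Vec n}
    (hp : p ∈ newtonPolytope ω) {T : ℝ} (hT : 0 ≤ T) (x : Vec n) :
    ∃ u i, ‖u‖ ≤ affDim (Set.range ω) * T ∧ ∀ l, inner ℝ (ω l - p) u ≤ inner ℝ (ω l - p) x ∨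
      inner ℝ (ω l - p) u ≤ inner ℝ (ω i - p) x - facetGap ω * T := by
  obtain ⟨y, hy, z, hz, rfl⟩ :=
    (vectorSpan ℝ (Set.range ω)).exists_add_mem_mem_orthogonal x
  have hproj (l : Fin N) : inner ℝ (ω l - p) (y + z) = inner ℝ (ω l - p) y := by
    have hmem : ω l - p ∈ vectorSpan ℝ (Set.range ω) :=
      vsub_mem_vectorSpan_of_mem_affineSpan_of_mem_affineSpan
        (mem_affineSpan ℝ (Set.mem_range_self l)) (convexHull_subset_affineSpan _ hp)
    rw [inner_add_right, Submodule.inner_right_of_mem_orthogonal hmem hz, add_zero]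
  obtain ⟨i, hi⟩ := exists_mem_innerDual_vertexDiffs ω y
  obtain ⟨u, hu, hyu, htight⟩ := exists_norm_le_sub_mem_innerDual (finite_vertexDiffs ω i) hT
    (fun v hv a ha => hv.inner_eq_zero_or_facetGap_le ha) (span_vertexDiffs ω i ▸ hy) hi
  have hvertex := inner_sub_nonneg_of_mem_newtonPolytope hp hyu
  refine ⟨u, i, by rwa [span_vertexDiffs] at hu, fun l => ?_⟩
  rw [hproj, hproj]
  simp only [inner_sub_left, inner_sub_right] at hvertex ⊢
  refine (htight _ (Set.mem_range_self l)).imp (fun h => ?_) fun h => ?_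
  · simp only [inner_sub_left, inner_sub_right] at h
    linarith
  · rw [inner_sub_left] at h
    linarith

theorem exists_norm_le_tilt_gpObjective_le [Nonempty (Fin N)] (hc : ∀ l, 0 < c l) {p : Vec n}
    (hp : p ∈ newtonPolytope ω) {T : ℝ} (hT : 0 ≤ T) (x : Vec n) :
    ∃ u, ‖u‖ ≤ affDim (Set.range ω) * T ∧ tilt (gpObjective c ω) p u ≤
      tilt (gpObjective c ω) p x + gpBeta c * Real.exp (-(facetGap ω * T)) := by
  obtain ⟨u, i, hu, hle⟩ := exists_forall_inner_le_or_le_sub hp hT x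
  refine ⟨u, hu, ?_⟩
  rw [tilt_gpObjective hc]
  exact gpObjective_le_add_gpBeta_mul_exp hc hle

theorem affDim_range_pos (hω : ∃ i j, ω i ≠ ω j) : 0 < affDim (Set.range ω) := by
  obtain ⟨i, j, hij⟩ := hω
  exact Submodule.one_le_finrank_iff.2 <| Submodule.ne_bot_iff _ |>.2 ⟨ω i - ω j,
    vsub_mem_vectorSpan ℝ (Set.mem_range_self i) (Set.mem_range_self j), sub_ne_zero.2 hij⟩

end GeometricProgramming

section ConvergenceRate

theorem exists_nonneg_sq_add_exp_le_gpBound {m β φ a : ℝ} (hm : 0 < m) (hβ : 0 < β) (hφ : 0 < φ)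
    (ha : m ^ 2 / (β * φ ^ 2) < a) :
    ∃ T, 0 ≤ T ∧ 2 * (m * T) ^ 2 / a + β * Real.exp (-(φ * T)) ≤ gpBound m β φ a := by
  have ha₀ : 0 < a := lt_trans (by positivity) ha
  set q := β * φ ^ 2 * a / m ^ 2 with hq
  have hq₁ : 1 ≤ q := by
    rw [div_lt_iff₀ (by positivity)] at ha
    rw [hq, one_le_div (by positivity)]
    linarith
  have hexp : β * Real.exp (-(φ * (Real.log q / φ))) = m ^ 2 / (φ ^ 2 * a) := by
    rw [mul_div_cancel₀ _ hφ.ne', Real.exp_neg, Real.exp_log (one_pos.trans_le hq₁), hq]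
    field_simp
  refine ⟨Real.log q / φ, div_nonneg (Real.log_nonneg hq₁) hφ.le, ?_⟩
  have hsq : 2 * (m * (Real.log q / φ)) ^ 2 / a = 2 * m ^ 2 / (φ ^ 2 * a) * Real.log q ^ 2 := by
    field_simp
  have hconst : m ^ 2 / (φ ^ 2 * a) ≤ 2 * m ^ 2 / (φ ^ 2 * a) := by
    gcongr
    linarith [sq_nonneg m]
  rw [hexp, hsq, gpBound, ← hq]
  linarith

variable {n N : ℕ} {c : Fin N → ℝ} {ω : Fin N → Vec n} {p : Vec n} {L : ℝ} {A : ℕ → ℝ}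
  {x : ℕ → Vec n}

theorem IsAGMIterates.tilt_gpObjective_sub_iInf_le [Nonempty (Fin N)]
    (hx : IsAGMIterates (gpObjective c ω) A 0 x) (hc : ∀ l, 0 < c l)
    (hf : IsSmoothConvex L (gpObjective c ω)) (hA : StepSizeCondition L A)
    (hp : IsMinNormPoint p (closure (conjugateDomain (gpObjective c ω)))) {k : ℕ}
    (hk : 0 < A k) {T : ℝ} (hT : 0 ≤ T) :
    tilt (gpObjective c ω) p (x k) - ⨅ u, tilt (gpObjective c ω) p u ≤
      2 * (affDim (Set.range ω) * T) ^ 2 / A k + gpBeta c * Real.exp (-(facetGap ω * T)) := by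
  rw [sub_le_comm]
  refine le_ciInf fun v => ?_
  obtain ⟨u, hu, huv⟩ := exists_norm_le_tilt_gpObjective_le hc
    (closure_conjugateDomain_gpObjective hc ▸ hp.1) hT v
  have hgap : tilt (gpObjective c ω) p (x k) - tilt (gpObjective c ω) p u ≤
      2 * (affDim (Set.range ω) * T) ^ 2 / A k := by
    rw [le_div_iff₀' hk]
    refine (hx.tilt_sub_le hf hA hp u k).trans ?_
    rw [zero_sub, norm_neg]
    gcongr
  linarith

end ConvergenceRate

theorem mainTheorem10 {n N : ℕ} (c : Fin N → ℝ) (hc : ∀ l, 0 < c l)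
    (ω : Fin N → Vec n) (hω : ∃ i j, ω i ≠ ω j)
    (f : Vec n → ℝ) (hf : f = gpObjective c ω)
    (pstar : Vec n) (hp : IsMinNormPoint pstar (closure (conjugateDomain f)))
    (g : Vec n → ℝ) (hg : g = tilt f pstar)
    (m β φ : ℝ) (hm : m = affDim (Set.range ω)) (hβ : β = gpBeta c) (hφ : φ = facetGap ω) :
    IsSmoothConvex (gpSmoothness ω) f ∧
    BddBelow (Set.range g) ∧
    ∀ (L : ℝ) (A : ℕ → ℝ) (x : ℕ → Vec n),
      IsSmoothConvex L f → StepSizeCondition L A → IsAGMIterates f A 0 x →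
        (∀ᶠ k in atTop, m ^ 2 / (β * φ ^ 2) < A k) ∧
        (∀ k, m ^ 2 / (β * φ ^ 2) < A k →
          ‖gradient f (x k) - pstar‖ ^ 2 / (2 * gpSmoothness ω) ≤ g (x k) - (⨅ u, g u) ∧
          g (x k) - (⨅ u, g u) ≤ gpBound m β φ (A k)) ∧
        (fun k : ℕ => gpBound m β φ (A k)) =O[atTop]
          (fun k : ℕ => Real.log k ^ 2 / (k : ℝ) ^ 2) := by
  subst hf hg
  have : Nonempty (Fin N) := hω.nonempty
  have hm₀ : 0 < m := hm ▸ Nat.cast_pos.2 (affDim_range_pos hω)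
  have hβ₀ : 0 < β := hβ ▸ gpBeta_pos hc
  have hφ₀ : 0 < φ := hφ ▸ facetGap_pos hω
  have hsmooth := isSmoothConvex_gpObjective hc hω
  have hbdd : BddBelow (Set.range (tilt (gpObjective c ω) pstar)) :=
    bddBelow_range_tilt_gpObjective hc (closure_conjugateDomain_gpObjective hc ▸ hp.1)
  refine ⟨hsmooth, hbdd, fun L A x hL hA hx => ⟨hA.tendsto_atTop.eventually_gt_atTop _,
    fun k hk => ⟨?_, ?_⟩, isBigO_gpBound hm₀.ne' hβ₀.ne' hφ₀.ne' hA.isTheta_sq⟩⟩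
  · rw [← gradient_tilt hsmooth.differentiable]
    exact (hsmooth.tilt pstar).norm_gradient_sq_div_le hbdd (x k)
  · have hk₀ : 0 < A k := lt_trans (by positivity) hk
    obtain ⟨T, hT, hbound⟩ := exists_nonneg_sq_add_exp_le_gpBound hm₀ hβ₀ hφ₀ hk
    subst hm hβ hφ
    exact (hx.tilt_gpObjective_sub_iInf_le hc hL hA hp hk₀ hT).trans hbound
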